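/- **Setting.** Let $(\Omega,\mathcal F)$ be a measurable space and let $C_{l,Lip}(\mathbb R^n)$ be the set of functions $\varphi:\mathbb R^n\to\mathbb R$ with $|\varphi(x)-\varphi(y)|\le C(1+|x|^m+|y|^m)|x-y|$ for all $x,y$, for some $C>0$, $m\in\mathbb N$; let $C_{b,Lip}(\mathbb R)$ be the set of bounded Lipschitz functions on $\mathbb R$. Let $\mathscr H$ be a linear space of measurable real functions on $\Omega$ such that $\varphi(X_1,\dots,X_n)\in\mathscr H$ whenever $X_1,\dots,X_n\in\mathscr H$ and $\varphi\in C_{l,Lip}(\mathbb R^n)$. Let $\mathbb E:\mathscr H\to[-\infty,\infty]$ be a sub-linear expectation, i.e. for all $X,Y\in\mathscr H$: $X\ge Y$ implies $\mathbb E[X]\ge\mathbb E[Y]$; $\mathbb E[c]=c$ for $c\in\mathbb R$; $\mathbb E[X+Y]\le\mathbb E[X]+\mathbb E[Y]$ whenever the right-hand side is not of the form $\infty-\infty$ or $-\infty+\infty$; $\mathbb E[\lambda X]=\lambda\mathbb E[X]$ for $\lambda\ge 0$ (with $0\cdot(\pm\infty)=0$). Put $\mathcal E[X]=-\mathbb E[-X]$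 (conjugate expectation), and for $A\subset\Omega$ $$\mathbb V(A)=\inf\{\mathbb E[\xi]:\ 1_A\le\xi,\ \xi\in\mathscr H\},\qquad \mathbb V^*(A)=\inf\Big\{\sum_{n\ge1}\mathbb V(A_n):\ A\subset\bigcup_{n\ge1} A_n,\ A_n\in\mathcal F\Big\},$$ and $C_{\mathbb V}(|X|)=\int_0^\infty\mathbb V(|X|\ge t)\,dt$ for $X\in\mathscr H$. The capacity $\mathbb V$ is *countably sub-additive* if $\mathbb V(\bigcup_n A_n)\le\sum_n\mathbb V(A_n)$ for all $A_n\in\mathcal F$, and *continuous* if $\mathbb V(A_n)\to\mathbb V(A)$ whenever $A_n\uparrow A$ or $A_n\downarrow A$ with $A_n\in\mathcal F$. A sequence $X_1,X_2,\dots\in\mathscr H$ is called * *identically distributed* if, for every $i$ and every $\varphi\in C_{l,Lip}(\mathbb R)$, $\mathbb E[\varphi(X_i)]=\mathbb E[\varphi(X_1)]$ whenever both are finite; * *upper* (resp. *lower*) *extended negatively dependent* if there is a constant $K\ge1$ with $\mathbb E[\prod_{i=1}^n g_i(X_i)]\le K\prod_{i=1}^n\mathbb E[g_i(X_i)]$ for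 all $n\ge1$ and all non-negative $g_i\in C_{b,Lip}(\mathbb R)$, $i\ge 1$, that are all non-decreasing (resp. all non-increasing); *extended negatively dependent* if both hold; * *extended independent* if $\mathbb E[\prod_{i=1}^n\psi_i(X_i)]=\prod_{i=1}^n\mathbb E[\psi_i(X_i)]$ for all $n\ge2$ and all non-negative $\psi_i\in C_{l,Lip}(\mathbb R)$ with $\mathbb E[\psi_i(X_i)]<\infty$, $1\le i\le n$. **Theorem** (Kolmogorov-type strong law of large numbers). Let $X_1,X_2,\dots\in\mathscr H$ be identically distributed and $S_n=\sum_{k=1}^nX_k$. (a) Suppose $\lim_{c\to\infty}\mathbb E[(|X_1|-c)^+]=0$ and $C_{\mathbb V}(|X_1|)<\infty$. If $X_1,X_2,\dots$ are upper extended negatively dependent, then $$\mathbb V^*\Big(\limsup_{n\to\infty}\frac{S_n}{n}>\mathbb E[X_1]\Big)=0 .$$ If $X_1,X_2,\dots$ are extended negatively dependent, then $$\mathbb V^*\Big(\Big\{\liminf_{n\to\infty}\frac{S_n}{n}<\mathcal E[X_1]\Big\}\cup\Big\{\limsup_{n\to\infty}\frac{S_n}{n}>\mathbb E[X_1]\Big\}\Big)=0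 .$$ (b) If $\mathbb V$ is countably sub-additive, then $\mathbb V^*(A)=\mathbb V(A)$ for all $A\in\mathcal F$, and (a) remains true with $\mathbb V^*$ replaced by $\mathbb V$. (c) If $\mathbb V$ is continuous, $X_1,X_2,\dots$ are extended independent, and $$\mathbb V\Big(\limsup_{n\to\infty}\frac{|S_n|}{n}=+\infty\Big)<1,$$ then $C_{\mathbb V}(|X_1|)<\infty$. -/

import Mathlib

open Filter Topology MeasureTheory
open scoped ENNReal

/-- The class `C_{l,Lip}` of locally Lipschitz functions with polynomially growing Lipschitz
constant. It is used for `F = ℝ` and for `F = Fin n → ℝ`; since all norms on `ℝⁿ` are equivalent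
and `C` is arbitrary, the choice of the norm on `ℝⁿ` is immaterial. -/
def IsLocLip {F : Type*} [NormedAddCommGroup F] (φ : F → ℝ) : Prop :=
  ∃ C : ℝ, 0 < C ∧ ∃ m : ℕ, ∀ x y : F,
    |φ x - φ y| ≤ C * (1 + ‖x‖ ^ m + ‖y‖ ^ m) * ‖x - y‖

/-- The class `C_{b,Lip}(ℝ)` of bounded Lipschitz functions. -/
def IsBddLip (g : ℝ → ℝ) : Prop :=
  ∃ C : ℝ, 0 < C ∧ (∀ x, |g x| ≤ C) ∧ ∀ x y, |g x - g y| ≤ C * |x - y|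

/-- A sub-linear expectation space `(Ω, H, E)` over a measurable space `Ω`: `H` is a linear space
of random variables (measurable real functions) stable under composition with `C_{l,Lip}`
functions, and `E` is a sub-linear expectation on `H` with values in `[-∞, ∞]`.
`E` is written as a function on all of `Ω → ℝ`, but it is constrained, and only ever used, on `H`. -/
structure SublinearSpace (Ω : Type*) [MeasurableSpace Ω] where
  /-- The space of random variables. -/
  H : Submodule ℝ (Ω → ℝ)
  measurable_of_mem : ∀ X ∈ H, Measurable X
  comp_mem : ∀ (n : ℕ) (X : Fin n → Ω → ℝ), (∀ i, X i ∈ H) →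
    ∀ φ : (Fin n → ℝ) → ℝ, IsLocLip φ → (fun ω => φ (fun i => X i ω)) ∈ H
  /-- The sub-linear expectation. -/
  E : (Ω → ℝ) → EReal
  mono : ∀ X ∈ H, ∀ Y ∈ H, (∀ ω, Y ω ≤ X ω) → E Y ≤ E X
  const : ∀ c : ℝ, E (fun _ => c) = (c : EReal)
  subadd : ∀ X ∈ H, ∀ Y ∈ H, ¬ (E X = ⊤ ∧ E Y = ⊥) → ¬ (E X = ⊥ ∧ E Y = ⊤) →
    E (fun ω => X ω + Y ω) ≤ E X + E Y
  pos_homog : ∀ X ∈ H, ∀ c : ℝ, 0 ≤ c → E (fun ω => c * X ω) = (c : EReal) * E X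

/-- `V` is countably sub-additive on the measurable sets. -/
def IsCountablySubadditive {Ω : Type*} [MeasurableSpace Ω] (V : Set Ω → ℝ≥0∞) : Prop :=
  ∀ A : ℕ → Set Ω, (∀ n, MeasurableSet (A n)) → V (⋃ n, A n) ≤ ∑' n, V (A n)

/-- `V` is continuous from below and from above on the measurable sets. -/
def IsContinuousCapacity {Ω : Type*} [MeasurableSpace Ω] (V : Set Ω → ℝ≥0∞) : Prop :=
  (∀ A : ℕ → Set Ω, (∀ n, MeasurableSet (A n)) → Monotone A →
    Tendsto (fun n => V (A n)) atTop (𝓝 (V (⋃ n, A n)))) ∧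
  (∀ A : ℕ → Set Ω, (∀ n, MeasurableSet (A n)) → Antitone A →
    Tendsto (fun n => V (A n)) atTop (𝓝 (V (⋂ n, A n))))

/-- The Choquet integral `∫₀^∞ V(X ≥ t) dt` of a non-negative function `X`. -/
noncomputable def choquet {Ω : Type*} (V : Set Ω → ℝ≥0∞) (X : Ω → ℝ) : ℝ≥0∞ :=
  ∫⁻ t in Set.Ioi (0 : ℝ), V {ω | t ≤ X ω}

/-- The partial sum `S_n = X_1 + ⋯ + X_n`, where the sequence `X_1, X_2, …` is written
`X 0, X 1, …`. -/
def partialSum {Ω : Type*} (X : ℕ → Ω → ℝ) (n : ℕ) (ω : Ω) : ℝ :=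
  ∑ i ∈ Finset.range n, X i ω

namespace SublinearSpace

variable {Ω : Type*} [MeasurableSpace Ω] (S : SublinearSpace Ω)

/-- The conjugate expectation `-E[-X]`. -/
noncomputable def conjE (X : Ω → ℝ) : EReal := -S.E (fun ω => -X ω)

/-- The upper capacity `V(A) = inf {E[ξ] : 1_A ≤ ξ, ξ ∈ H}`. The infimum, taken in `[-∞, ∞]`,
lies in `[0, 1]`, so that nothing is lost by viewing it in `[0, ∞]`. -/
noncomputable def V (A : Set Ω) : ℝ≥0∞ :=
  (sInf {e : EReal | ∃ ξ ∈ S.H, (∀ ω, A.indicator (fun _ => (1 : ℝ)) ω ≤ ξ ω) ∧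
    e = S.E ξ}).toENNReal

/-- The outer capacity `V*(A) = inf {∑ V(A_n) : A ⊆ ⋃ A_n}`, over sequences of measurable sets. -/
noncomputable def outerV (A : Set Ω) : ℝ≥0∞ :=
  sInf {e : ℝ≥0∞ | ∃ B : ℕ → Set Ω, (∀ n, MeasurableSet (B n)) ∧ A ⊆ ⋃ n, B n ∧
    e = ∑' n, S.V (B n)}

/-- `X` and `Y` are identically distributed: `E[φ(X)] = E[φ(Y)]` for all `φ` in `C_{l,Lip}(ℝ)`
for which both expectations are finite. -/
def SameDistrib (X Y : Ω → ℝ) : Prop :=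
  ∀ φ : ℝ → ℝ, IsLocLip φ →
    S.E (fun ω => φ (X ω)) ≠ ⊤ → S.E (fun ω => φ (X ω)) ≠ ⊥ →
    S.E (fun ω => φ (Y ω)) ≠ ⊤ → S.E (fun ω => φ (Y ω)) ≠ ⊥ →
    S.E (fun ω => φ (X ω)) = S.E (fun ω => φ (Y ω))

/-- Extended independence: `E[∏ ψ_i(X_i)] = ∏ E[ψ_i(X_i)]` for all non-negative `ψ_i` in
`C_{l,Lip}(ℝ)` with finite `E[ψ_i(X_i)]`. -/
def ExtIndep (X : ℕ → Ω → ℝ) : Prop :=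
  ∀ n : ℕ, 2 ≤ n → ∀ ψ : ℕ → ℝ → ℝ, (∀ i, IsLocLip (ψ i)) → (∀ i x, 0 ≤ ψ i x) →
    (∀ i < n, S.E (fun ω => ψ i (X i ω)) < ⊤) →
    S.E (fun ω => ∏ i ∈ Finset.range n, ψ i (X i ω)) =
      ∏ i ∈ Finset.range n, S.E (fun ω => ψ i (X i ω))

/-- Upper extended negative dependence. -/
def UpperEND (X : ℕ → Ω → ℝ) : Prop :=
  ∃ K : ℝ, 1 ≤ K ∧ ∀ g : ℕ → ℝ → ℝ, (∀ i, IsBddLip (g i)) → (∀ i x, 0 ≤ g i x) →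
    (∀ i, Monotone (g i)) → ∀ n : ℕ, 1 ≤ n →
    S.E (fun ω => ∏ i ∈ Finset.range n, g i (X i ω)) ≤
      (K : EReal) * ∏ i ∈ Finset.range n, S.E (fun ω => g i (X i ω))

/-- Lower extended negative dependence. -/
def LowerEND (X : ℕ → Ω → ℝ) : Prop :=
  ∃ K : ℝ, 1 ≤ K ∧ ∀ g : ℕ → ℝ → ℝ, (∀ i, IsBddLip (g i)) → (∀ i x, 0 ≤ g i x) →
    (∀ i, Antitone (g i)) → ∀ n : ℕ, 1 ≤ n →
    S.E (fun ω => ∏ i ∈ Finset.range n, g i (X i ω)) ≤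
      (K : EReal) * ∏ i ∈ Finset.range n, S.E (fun ω => g i (X i ω))

/-- Extended negative dependence. -/
def END (X : ℕ → Ω → ℝ) : Prop := S.UpperEND X ∧ S.LowerEND X

/-- The event `{limsup S_n / n > E[X_1]}` (the upper limit is taken in `[-∞, ∞]`). -/
def upperEvent (X : ℕ → Ω → ℝ) : Set Ω :=
  {ω | S.E (X 0) < limsup (fun n : ℕ => ((partialSum X n ω / n : ℝ) : EReal)) atTop}

/-- The event `{liminf S_n / n < -E[-X_1]}` (the lower limit is taken in `[-∞, ∞]`). -/
def lowerEvent (X : ℕ → Ω → ℝ) : Set Ω :=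
  {ω | liminf (fun n : ℕ => ((partialSum X n ω / n : ℝ) : EReal)) atTop < S.conjE (X 0)}

end SublinearSpace

/-!
# Kolmogorov-type strong law of large numbers under a sub-linear expectation

Apart from the mean and the integrability condition on the first variable, only bounded Lipschitz
functions of single variables enter the proof. Their expectations are finite, so they are handled as
real numbers (`SublinearSpace.Er`), and they are the same for all variables
of an identically distributed sequence (`SublinearSpace.SameDistrib.Er_eq`), even where the
variables themselves have infinite expectation. The outer capacity is the outer measure generated by
the capacity on measurable sets, so the first Borel–Cantelli lemma and the stability of null sets
under countable unions are available for it.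

*Sufficiency.* Split `x ≤ max (-c) (min x c) + max (x - c) 0`. Both summands are monotone in `x`, so
negative dependence gives a Chernoff bound for their sums (`SublinearSpace.V_le_sum_le`). For the
bounded summand the capacities of upper deviations decay exponentially, and the averages are
eventually below any level above the mean. The excess over `c` is non-negative, so it suffices to
control it along the times `2 ^ k`, and a bound up to a constant factor is enough because its mean
tends to `0` as `c → ∞`. After truncation at `2 ^ k`, the Chernoff bound with a suitable exponent
is, up to a constant, the second moment divided by `2 ^ k`
(`SublinearSpace.V_le_truncated_sum_le`); this and the capacities of the truncation errors have
finite sums over `k` when the Choquet integral of `|X|` is finite. The lower law is the upper law for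
`-X`.

*Necessity.* Upper expectations of complements are of no use for a second Borel–Cantelli lemma, as
they involve the lower capacity. Instead, a second-moment argument is applied to products of
`1 + b i * g i (X i)` with `g i` a smoothed indicator of `{|x| > M * (i + 1)}` and small weights
`b i`: extended independence computes the mean and bounds the second moment of the product
(`SublinearSpace.le_V_exists_pos`). If the Choquet integral is infinite, then infinitely many of the
events `|X i| > M * (i + 1)` occur on a set of full capacity; by continuity from above this
holds for all `M` simultaneously, and then the averages are unbounded.
-/

/-! ### Bounded Lipschitz functions -/

theorem IsBddLip.isLocLip {g : ℝ → ℝ} (hg : IsBddLip g) : IsLocLip g := by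
  obtain ⟨C, hC, -, h⟩ := hg
  refine ⟨C, hC, 0, fun x y => (h x y).trans ?_⟩
  have := abs_nonneg (x - y)
  simp only [pow_zero, Real.norm_eq_abs]
  nlinarith [mul_nonneg hC.le this]

/-- Separate bounds for the size and for the Lipschitz constant suffice. -/
theorem IsBddLip.of_bounds {g : ℝ → ℝ} (B L : ℝ) (hB : ∀ x, |g x| ≤ B)
    (hL : ∀ x y, |g x - g y| ≤ L * |x - y|) : IsBddLip g := by
  refine ⟨max 1 (max B L), lt_max_of_lt_left one_pos, fun x => (hB x).trans ?_,
    fun x y => (hL x y).trans ?_⟩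
  · exact (le_max_left _ _).trans (le_max_right _ _)
  · exact mul_le_mul_of_nonneg_right ((le_max_right _ _).trans (le_max_right _ _))
      (abs_nonneg _)

theorem IsBddLip.const (c : ℝ) : IsBddLip (fun _ => c) :=
  .of_bounds |c| 0 (fun _ => le_rfl) (by simp)

theorem IsBddLip.const_mul {g : ℝ → ℝ} (hg : IsBddLip g) (a : ℝ) :
    IsBddLip (fun x => a * g x) := by
  obtain ⟨C, hC, hb, h⟩ := hg
  refine .of_bounds (|a| * C) (|a| * C) (fun x => ?_) (fun x y => ?_)
  · rw [abs_mul]; exact mul_le_mul_of_nonneg_left (hb x) (abs_nonneg a)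
  · rw [← mul_sub, abs_mul, mul_assoc]
    exact mul_le_mul_of_nonneg_left (h x y) (abs_nonneg a)

theorem IsBddLip.add {f g : ℝ → ℝ} (hf : IsBddLip f) (hg : IsBddLip g) :
    IsBddLip (fun x => f x + g x) := by
  obtain ⟨C, hC, hb, h⟩ := hf
  obtain ⟨D, hD, hb', h'⟩ := hg
  refine .of_bounds (C + D) (C + D) (fun x => ?_) (fun x y => ?_)
  · exact (abs_add_le _ _).trans (add_le_add (hb x) (hb' x))
  · calc |f x + g x - (f y + g y)| = |(f x - f y) + (g x - g y)| := by ring_nf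
      _ ≤ |f x - f y| + |g x - g y| := abs_add_le _ _
      _ ≤ _ := by linarith [h x y, h' x y]

theorem IsBddLip.sub_const {f : ℝ → ℝ} (hf : IsBddLip f) (c : ℝ) :
    IsBddLip (fun x => f x - c) := by
  simpa [sub_eq_add_neg] using hf.add (.const (-c))

theorem IsBddLip.mul {f g : ℝ → ℝ} (hf : IsBddLip f) (hg : IsBddLip g) :
    IsBddLip (fun x => f x * g x) := by
  obtain ⟨C, hC, hb, h⟩ := hf
  obtain ⟨D, hD, hb', h'⟩ := hg
  refine .of_bounds (C * D) (C * D + C * D) (fun x => ?_) (fun x y => ?_)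
  · rw [abs_mul]; exact mul_le_mul (hb x) (hb' x) (abs_nonneg _) hC.le
  · calc |f x * g x - f y * g y| = |f x * (g x - g y) + (f x - f y) * g y| := by ring_nf
      _ ≤ |f x| * |g x - g y| + |f x - f y| * |g y| := by
        rw [← abs_mul, ← abs_mul]; exact abs_add_le _ _
      _ ≤ C * (D * |x - y|) + (C * |x - y|) * D :=
        add_le_add (mul_le_mul (hb x) (h' x y) (abs_nonneg _) hC.le)
          (mul_le_mul (h x y) (hb' y) (abs_nonneg _) (mul_nonneg hC.le (abs_nonneg _)))
      _ = _ := by ring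

/-- The exponential of a bounded Lipschitz function is one, since `exp` is Lipschitz on bounded
sets. -/
theorem IsBddLip.exp {g : ℝ → ℝ} (hg : IsBddLip g) : IsBddLip (fun x => Real.exp (g x)) := by
  obtain ⟨C, hC, hb, h⟩ := hg
  have key : ∀ a b : ℝ, b ≤ C → b - a ≤ |b - a| →
      Real.exp b - Real.exp a ≤ Real.exp C * |b - a| := by
    intro a b hbC hab
    have h1 : Real.exp b * (1 + (a - b)) ≤ Real.exp a := by
      calc Real.exp b * (1 + (a - b)) ≤ Real.exp b * Real.exp (a - b) := by
            gcongr; linarith [Real.add_one_le_exp (a - b)]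
        _ = Real.exp a := by rw [← Real.exp_add]; ring_nf
    have h2 : Real.exp b * (b - a) ≤ Real.exp C * |b - a| := by
      calc Real.exp b * (b - a) ≤ Real.exp b * |b - a| := by gcongr
        _ ≤ _ := by gcongr
    linarith
  refine .of_bounds (Real.exp C) (Real.exp C * C) (fun x => ?_) (fun x y => ?_)
  · rw [abs_of_pos (Real.exp_pos _)]
    exact Real.exp_le_exp.2 ((le_abs_self _).trans (hb x))
  · have hx := key (g y) (g x) ((le_abs_self _).trans (hb x)) (le_abs_self _)
    have hy := key (g x) (g y) ((le_abs_self _).trans (hb y)) (le_abs_self _)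
    rw [abs_sub_comm (g y)] at hy
    have : Real.exp C * |g x - g y| ≤ Real.exp C * C * |x - y| := by
      rw [mul_assoc]; exact mul_le_mul_of_nonneg_left (h x y) (Real.exp_pos _).le
    rw [abs_le]
    constructor <;> linarith

/-- Clamping a Lipschitz function to an interval gives a bounded Lipschitz function. -/
theorem IsBddLip.clamp {f : ℝ → ℝ} (L : ℝ) (hf : ∀ x y, |f x - f y| ≤ L * |x - y|) (a b : ℝ)
    (hab : a ≤ b) : IsBddLip (fun x => max a (min (f x) b)) := by
  refine .of_bounds (max |a| |b|) L (fun x => ?_) (fun x y => ?_)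
  · exact abs_le_max_abs_abs (le_max_left _ _) (max_le hab (min_le_right _ _))
  · refine le_trans ?_ (hf x y)
    refine (abs_max_sub_max_le_max _ _ _ _).trans ?_
    refine max_le (by simp) ?_
    refine (abs_min_sub_min_le_max _ _ _ _).trans ?_
    simp

theorem IsBddLip.comp_neg {g : ℝ → ℝ} (hg : IsBddLip g) : IsBddLip (fun x => g (-x)) := by
  obtain ⟨C, hC, hb, h⟩ := hg
  refine ⟨C, hC, fun x => hb _, fun x y => (h _ _).trans_eq ?_⟩
  rw [← abs_neg (x - y)]; ring_nf

namespace SublinearSpace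

variable {Ω : Type*} [MeasurableSpace Ω] (S : SublinearSpace Ω)

/-! ### The sub-linear expectation on bounded random variables -/

theorem comp_mem_one {φ : ℝ → ℝ} (hφ : IsLocLip φ) {X : Ω → ℝ} (hX : X ∈ S.H) :
    (fun ω => φ (X ω)) ∈ S.H := by
  refine S.comp_mem 1 (fun _ => X) (fun _ => hX) (fun v => φ (v 0)) ?_
  obtain ⟨C, hC, m, h⟩ := hφ
  refine ⟨C, hC, m, fun x y => (h _ _).trans ?_⟩
  gcongr
  · exact norm_le_pi_norm x 0
  · exact norm_le_pi_norm y 0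
  · exact norm_le_pi_norm (x - y) 0

theorem const_mem (c : ℝ) : (fun _ : Ω => c) ∈ S.H := by
  refine S.comp_mem 0 Fin.elim0 (fun i => i.elim0) (fun _ => c) ⟨1, one_pos, 0, fun x y => ?_⟩
  simp only [sub_self, abs_zero]; positivity

theorem abs_mem {X : Ω → ℝ} (hX : X ∈ S.H) : (fun ω => |X ω|) ∈ S.H := by
  refine S.comp_mem_one (φ := fun x => |x|) ⟨1, one_pos, 0, fun x y => ?_⟩ hX
  have := abs_abs_sub_abs_le x y
  have := abs_nonneg (x - y)
  simp only [pow_zero, Real.norm_eq_abs]; linarith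

theorem mul_mem {X Y : Ω → ℝ} (hX : X ∈ S.H) (hY : Y ∈ S.H) :
    (fun ω => X ω * Y ω) ∈ S.H := by
  have hsq : ∀ Z ∈ S.H, (fun ω => Z ω ^ 2) ∈ S.H := by
    intro Z hZ
    refine S.comp_mem_one (φ := fun x => x ^ 2) ⟨1, one_pos, 1, fun x y => ?_⟩ hZ
    simp only [pow_one, Real.norm_eq_abs, one_mul]
    rw [sq_sub_sq, abs_mul]
    refine mul_le_mul_of_nonneg_right ?_ (abs_nonneg _)
    linarith [abs_add_le x y]
  -- polarization
  have : (fun ω => X ω * Y ω) =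
      (1 / 2 : ℝ) • ((fun ω => (X + Y) ω ^ 2) - (fun ω => X ω ^ 2) - fun ω => Y ω ^ 2) := by
    ext ω; simp only [Pi.add_apply, Pi.smul_apply, Pi.sub_apply, smul_eq_mul]; ring
  rw [this]
  exact S.H.smul_mem _ (S.H.sub_mem (S.H.sub_mem (hsq _ (S.H.add_mem hX hY)) (hsq _ hX))
    (hsq _ hY))

/-- Bounded random variables. -/
def IsBddRV (X : Ω → ℝ) : Prop := X ∈ S.H ∧ ∃ C : ℝ, ∀ ω, |X ω| ≤ C

/-- The sub-linear expectation as a real number; it carries the value of `S.E` on bounded random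
variables, and is junk where `S.E` is infinite. -/
noncomputable def Er (X : Ω → ℝ) : ℝ := (S.E X).toReal

variable {S}

theorem IsBddRV.const (c : ℝ) : S.IsBddRV (fun _ => c) := ⟨S.const_mem c, |c|, fun _ => le_rfl⟩

theorem IsBddRV.add {X Y : Ω → ℝ} (hX : S.IsBddRV X) (hY : S.IsBddRV Y) :
    S.IsBddRV (fun ω => X ω + Y ω) := by
  obtain ⟨hX, C, hC⟩ := hX
  obtain ⟨hY, D, hD⟩ := hY
  exact ⟨S.H.add_mem hX hY, C + D,
    fun ω => (abs_add_le _ _).trans (add_le_add (hC ω) (hD ω))⟩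

theorem IsBddRV.const_mul {X : Ω → ℝ} (hX : S.IsBddRV X) (a : ℝ) :
    S.IsBddRV (fun ω => a * X ω) := by
  obtain ⟨hX, C, hC⟩ := hX
  refine ⟨S.H.smul_mem a hX, |a| * C, fun ω => ?_⟩
  rw [abs_mul]; exact mul_le_mul_of_nonneg_left (hC ω) (abs_nonneg a)

theorem IsBddRV.mul {X Y : Ω → ℝ} (hX : S.IsBddRV X) (hY : S.IsBddRV Y) :
    S.IsBddRV (fun ω => X ω * Y ω) := by
  obtain ⟨hX, C, hC⟩ := hX
  obtain ⟨hY, D, hD⟩ := hY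
  refine ⟨S.mul_mem hX hY, C * D, fun ω => ?_⟩
  rw [abs_mul]
  exact mul_le_mul (hC ω) (hD ω) (abs_nonneg _) ((abs_nonneg _).trans (hC ω))

theorem IsBddRV.sum {ι : Type*} (s : Finset ι) {X : ι → Ω → ℝ}
    (hX : ∀ i ∈ s, S.IsBddRV (X i)) : S.IsBddRV (fun ω => ∑ i ∈ s, X i ω) := by
  classical
  induction s using Finset.induction_on with
  | empty => simpa using IsBddRV.const (S := S) 0
  | insert a s ha ih =>
    simp only [Finset.sum_insert ha]
    exact (hX a (by simp)).add (ih fun i hi => hX i (by simp [hi]))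

theorem IsBddRV.prod {ι : Type*} (s : Finset ι) {X : ι → Ω → ℝ}
    (hX : ∀ i ∈ s, S.IsBddRV (X i)) : S.IsBddRV (fun ω => ∏ i ∈ s, X i ω) := by
  classical
  induction s using Finset.induction_on with
  | empty => simpa using IsBddRV.const (S := S) 1
  | insert a s ha ih =>
    simp only [Finset.prod_insert ha]
    exact (hX a (by simp)).mul (ih fun i hi => hX i (by simp [hi]))

theorem _root_.IsBddLip.isBddRV {g : ℝ → ℝ} (hg : IsBddLip g) {X : Ω → ℝ} (hX : X ∈ S.H) :
    S.IsBddRV (fun ω => g (X ω)) := by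
  refine ⟨S.comp_mem_one hg.isLocLip hX, ?_⟩
  obtain ⟨C, -, hb, -⟩ := hg
  exact ⟨C, fun ω => hb _⟩

theorem IsBddRV.ne_top {X : Ω → ℝ} (hX : S.IsBddRV X) : S.E X ≠ ⊤ := by
  obtain ⟨hX, C, hC⟩ := hX
  have := S.mono _ (S.const_mem C) _ hX fun ω => (le_abs_self _).trans (hC ω)
  rw [S.const] at this
  exact ne_top_of_le_ne_top (EReal.coe_ne_top C) this

theorem IsBddRV.ne_bot {X : Ω → ℝ} (hX : S.IsBddRV X) : S.E X ≠ ⊥ := by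
  obtain ⟨hX, C, hC⟩ := hX
  have := S.mono _ hX _ (S.const_mem (-C)) fun ω => neg_le_of_abs_le (hC ω)
  rw [S.const] at this
  exact ne_bot_of_le_ne_bot (EReal.coe_ne_bot (-C)) this

theorem IsBddRV.coe_Er {X : Ω → ℝ} (hX : S.IsBddRV X) : ((S.Er X : ℝ) : EReal) = S.E X :=
  EReal.coe_toReal hX.ne_top hX.ne_bot

theorem Er_const (c : ℝ) : S.Er (fun _ => c) = c := by simp [Er, S.const]

theorem Er_mono {X Y : Ω → ℝ} (hX : S.IsBddRV X) (hY : S.IsBddRV Y) (h : ∀ ω, X ω ≤ Y ω) :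
    S.Er X ≤ S.Er Y := by
  rw [← EReal.coe_le_coe_iff, hX.coe_Er, hY.coe_Er]
  exact S.mono _ hY.1 _ hX.1 h

theorem Er_add_le {X Y : Ω → ℝ} (hX : S.IsBddRV X) (hY : S.IsBddRV Y) :
    S.Er (fun ω => X ω + Y ω) ≤ S.Er X + S.Er Y := by
  rw [← EReal.coe_le_coe_iff, (hX.add hY).coe_Er, EReal.coe_add, hX.coe_Er, hY.coe_Er]
  exact S.subadd _ hX.1 _ hY.1 (fun h => hX.ne_top h.1) (fun h => hX.ne_bot h.1)

theorem Er_const_mul {X : Ω → ℝ} (hX : S.IsBddRV X) {c : ℝ} (hc : 0 ≤ c) :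
    S.Er (fun ω => c * X ω) = c * S.Er X := by
  rw [Er, S.pos_homog _ hX.1 c hc, EReal.toReal_mul, EReal.toReal_coe, Er]

theorem Er_nonneg {X : Ω → ℝ} (hX : S.IsBddRV X) (h : ∀ ω, 0 ≤ X ω) : 0 ≤ S.Er X := by
  simpa [Er_const] using Er_mono (IsBddRV.const 0) hX h

theorem Er_sum_le {ι : Type*} (s : Finset ι) {X : ι → Ω → ℝ} (hX : ∀ i ∈ s, S.IsBddRV (X i)) :
    S.Er (fun ω => ∑ i ∈ s, X i ω) ≤ ∑ i ∈ s, S.Er (X i) := by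
  classical
  induction s using Finset.induction_on with
  | empty => simp [Er_const]
  | insert a s ha ih =>
    simp only [Finset.sum_insert ha]
    have hs : ∀ i ∈ s, S.IsBddRV (X i) := fun i hi => hX i (by simp [hi])
    exact (Er_add_le (hX a (by simp)) (.sum s hs)).trans (by linarith [ih hs])

/-- Adding a constant shifts the expectation. -/
theorem Er_add_const {X : Ω → ℝ} (hX : S.IsBddRV X) (c : ℝ) :
    S.Er (fun ω => X ω + c) = S.Er X + c := by
  apply le_antisymm
  · simpa [Er_const] using Er_add_le hX (IsBddRV.const c)
  · have := Er_add_le (hX.add (IsBddRV.const c)) (IsBddRV.const (-c))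
    simp only [Er_const, add_neg_cancel_right] at this
    linarith

/-- The expectation of a bounded Lipschitz function is the same for all variables of an
identically distributed sequence. -/
theorem SameDistrib.Er_eq {X Y : Ω → ℝ} (h : S.SameDistrib X Y) (hX : X ∈ S.H) (hY : Y ∈ S.H)
    {g : ℝ → ℝ} (hg : IsBddLip g) :
    S.Er (fun ω => g (X ω)) = S.Er (fun ω => g (Y ω)) := by
  have h1 := hg.isBddRV (S := S) hX
  have h2 := hg.isBddRV (S := S) hY
  rw [Er, h g hg.isLocLip h1.ne_top h1.ne_bot h2.ne_top h2.ne_bot, Er]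

theorem coe_prod_Er (n : ℕ) {X : ℕ → Ω → ℝ} (hX : ∀ i ∈ Finset.range n, S.IsBddRV (X i)) :
    ((∏ i ∈ Finset.range n, S.Er (X i) : ℝ) : EReal) = ∏ i ∈ Finset.range n, S.E (X i) := by
  induction n with
  | zero => simp
  | succ n ih =>
    rw [Finset.prod_range_succ, Finset.prod_range_succ, EReal.coe_mul,
      ih fun i hi => hX i (by simp at hi ⊢; omega), (hX n (by simp)).coe_Er]

/-! ### The capacity -/

theorem V_le_of_indicator_le {A : Set Ω} {ξ : Ω → ℝ} (hξ : S.IsBddRV ξ) (h0 : ∀ ω, 0 ≤ ξ ω)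
    (h1 : ∀ ω ∈ A, 1 ≤ ξ ω) : S.V A ≤ ENNReal.ofReal (S.Er ξ) := by
  rw [← EReal.real_coe_toENNReal, hξ.coe_Er]
  refine EReal.toENNReal_le_toENNReal (sInf_le ⟨ξ, hξ.1, fun ω => ?_, rfl⟩)
  by_cases hω : ω ∈ A
  · simpa [hω] using h1 ω hω
  · simpa [hω] using h0 ω

/-- To bound `V A` from below it suffices to consider dominating variables with values in
`[0, 1]`, as any dominating variable may be truncated at `1`. -/
theorem le_V {A : Set Ω} {b : ℝ}
    (h : ∀ ξ, S.IsBddRV ξ → (∀ ω, 0 ≤ ξ ω) → (∀ ω, ξ ω ≤ 1) → (∀ ω ∈ A, ξ ω = 1) → b ≤ S.Er ξ) :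
    ENNReal.ofReal b ≤ S.V A := by
  rw [← EReal.real_coe_toENNReal]
  refine EReal.toENNReal_le_toENNReal (le_sInf ?_)
  rintro _ ⟨ξ, hξ, hA, rfl⟩
  have hξ0 : ∀ ω, 0 ≤ ξ ω := fun ω => (Set.indicator_nonneg (fun _ _ => zero_le_one) ω).trans (hA ω)
  have hc : IsBddLip (fun x : ℝ => max 0 (min x 1)) :=
    .clamp 1 (fun x y => by simp) 0 1 zero_le_one
  have hζ := hc.isBddRV (S := S) hξ
  refine le_trans ?_ (S.mono _ hξ _ hζ.1 fun ω => max_le (hξ0 ω) (min_le_left _ _))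
  rw [← hζ.coe_Er, EReal.coe_le_coe_iff]
  refine h _ hζ (fun ω => le_max_left _ _) (fun ω => max_le zero_le_one (min_le_right _ _)) ?_
  intro ω hω
  have : 1 ≤ ξ ω := by simpa [hω] using hA ω
  simp [this]

theorem Er_le_V {A : Set Ω} {ξ : Ω → ℝ} (hξ : S.IsBddRV ξ) (h0 : ∀ ω ∉ A, ξ ω ≤ 0)
    (h1 : ∀ ω, ξ ω ≤ 1) : ENNReal.ofReal (S.Er ξ) ≤ S.V A := by
  refine le_V fun ζ hζ hζ0 _ hζA => Er_mono hξ hζ fun ω => ?_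
  by_cases hω : ω ∈ A
  · exact (h1 ω).trans (hζA ω hω).ge
  · exact (h0 ω hω).trans (hζ0 ω)

theorem V_mono {A B : Set Ω} (h : A ⊆ B) : S.V A ≤ S.V B := by
  refine EReal.toENNReal_le_toENNReal (sInf_le_sInf ?_)
  rintro _ ⟨ξ, hξ, hB, rfl⟩
  exact ⟨ξ, hξ, fun ω => (Set.indicator_le_indicator_of_subset h (fun _ => zero_le_one) ω).trans
    (hB ω), rfl⟩

theorem V_empty : S.V ∅ = 0 := by
  have := V_le_of_indicator_le (S := S) (A := ∅) (IsBddRV.const 0) (fun _ => le_rfl) (by simp)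
  simpa [Er_const] using this

theorem V_le_one (A : Set Ω) : S.V A ≤ 1 := by
  simpa [Er_const] using V_le_of_indicator_le (S := S) (A := A) (IsBddRV.const 1)
    (fun _ => zero_le_one) (fun _ _ => le_rfl)

/-- Each value of the capacity is approximated by expectations of dominating bounded variables. -/
theorem exists_Er_lt {A : Set Ω} {b : ℝ} (hb : S.V A < ENNReal.ofReal b) :
    ∃ ξ, S.IsBddRV ξ ∧ (∀ ω, 0 ≤ ξ ω) ∧ (∀ ω ∈ A, ξ ω = 1) ∧ S.Er ξ < b := by
  by_contra! hcon
  exact absurd (le_V fun ξ h h0 _ hA => hcon ξ h h0 hA) (not_le.2 hb)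

theorem V_union_le (A B : Set Ω) : S.V (A ∪ B) ≤ S.V A + S.V B := by
  refine ENNReal.le_of_forall_pos_le_add fun ε hε _ => ?_
  have key : ∀ A : Set Ω, ∃ ξ, S.IsBddRV ξ ∧ (∀ ω, 0 ≤ ξ ω) ∧ (∀ ω ∈ A, ξ ω = 1) ∧
      S.Er ξ < (S.V A).toReal + ε / 2 := by
    intro A
    have hA : S.V A ≠ ⊤ := ne_top_of_le_ne_top ENNReal.one_ne_top (V_le_one A)
    refine exists_Er_lt ?_
    rw [ENNReal.lt_ofReal_iff_toReal_lt hA]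
    have : (0 : ℝ) < ε := hε
    linarith
  obtain ⟨ξ, h1, h2, h3, h4⟩ := key A
  obtain ⟨ζ, k1, k2, k3, k4⟩ := key B
  have hA : S.V A ≠ ⊤ := ne_top_of_le_ne_top ENNReal.one_ne_top (V_le_one A)
  have hB : S.V B ≠ ⊤ := ne_top_of_le_ne_top ENNReal.one_ne_top (V_le_one B)
  calc S.V (A ∪ B) ≤ ENNReal.ofReal (S.Er fun ω => ξ ω + ζ ω) := by
        refine V_le_of_indicator_le (h1.add k1) (fun ω => add_nonneg (h2 ω) (k2 ω)) ?_
        rintro ω (hω | hω)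
        · linarith [h3 ω hω, k2 ω]
        · linarith [k3 ω hω, h2 ω]
    _ ≤ ENNReal.ofReal ((S.V A).toReal + (S.V B).toReal + ε) := by
        refine ENNReal.ofReal_le_ofReal ((Er_add_le h1 k1).trans ?_)
        linarith
    _ = S.V A + S.V B + ε := by
        rw [ENNReal.ofReal_add (by positivity) (by positivity),
          ENNReal.ofReal_add (by positivity) (by positivity), ENNReal.ofReal_toReal hA,
          ENNReal.ofReal_toReal hB]
        simp

theorem V_biUnion_le {ι : Type*} (s : Finset ι) (A : ι → Set Ω) :
    S.V (⋃ i ∈ s, A i) ≤ ∑ i ∈ s, S.V (A i) := by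
  classical
  induction s using Finset.induction_on with
  | empty => simp [V_empty]
  | insert a s ha ih =>
    rw [Finset.sum_insert ha, Finset.set_biUnion_insert]
    exact (V_union_le _ _).trans (by gcongr)

/-! ### The outer capacity -/

variable (S) in
open Classical in
/-- The outer measure generated by `V` on the measurable sets; it coincides with `S.outerV`, see
`outerMeasureV_apply`. -/
noncomputable def outerMeasureV : OuterMeasure Ω :=
  OuterMeasure.ofFunction (fun A => if MeasurableSet A then S.V A else ⊤) (by simp [V_empty])

theorem outerMeasureV_apply (A : Set Ω) : S.outerMeasureV A = S.outerV A := by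
  classical
  rw [outerMeasureV, OuterMeasure.ofFunction_eq_iInf_mem (P := MeasurableSet) _ _
    (fun s hs => by simp [hs])]
  apply le_antisymm
  · refine le_sInf ?_
    rintro _ ⟨B, hB, hAB, rfl⟩
    refine (iInf₂_le B hB).trans ((iInf_le _ hAB).trans ?_)
    simp [hB]
  · refine le_iInf fun B => le_iInf fun hB => le_iInf fun hAB => sInf_le ⟨B, hB, hAB, ?_⟩
    simp [hB]

theorem outerV_le_V {A : Set Ω} (hA : MeasurableSet A) : S.outerV A ≤ S.V A := by
  classical
  rw [← outerMeasureV_apply]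
  exact (OuterMeasure.ofFunction_le A).trans (by simp [hA])

theorem V_eq_outerV (hV : IsCountablySubadditive S.V) {A : Set Ω} (hA : MeasurableSet A) :
    S.outerV A = S.V A := by
  refine le_antisymm (outerV_le_V hA) (le_sInf ?_)
  rintro _ ⟨B, hB, hAB, rfl⟩
  exact (V_mono hAB).trans (hV B hB)

/-- The first Borel–Cantelli lemma for the outer capacity. -/
theorem outerV_frequently_eq_zero {A : ℕ → Set Ω} (hA : ∀ n, MeasurableSet (A n))
    (hsum : ∑' n, S.V (A n) ≠ ⊤) : S.outerV {ω | ∃ᶠ n in atTop, ω ∈ A n} = 0 := by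
  rw [← outerMeasureV_apply]
  refine measure_setOfPred_frequently_eq_zero (μ := S.outerMeasureV) (p := fun n ω => ω ∈ A n)
    (ne_top_of_le_ne_top hsum (ENNReal.tsum_le_tsum fun n => ?_))
  exact (outerMeasureV_apply _).trans_le (outerV_le_V (hA n))

end SublinearSpace

/-! ### Exponential bounds -/

/-- Compare the power series termwise: `(u * x) ^ k ≤ x ^ 2 * u ^ k` for `k ≥ 2`. -/
theorem exp_mul_le_of_le_one {u x : ℝ} (hu : 0 ≤ u) (hx : 0 ≤ x) (hx1 : x ≤ 1) :
    Real.exp (u * x) ≤ 1 + u * x + x ^ 2 * Real.exp u := by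
  have hs : ∀ y : ℝ, HasSum (fun k : ℕ => y ^ k / (k.factorial : ℝ)) (Real.exp y) := by
    intro y
    rw [Real.exp_eq_exp_ℝ]
    exact NormedSpace.exp_series_hasSum_exp' (𝕂 := ℝ) y |>.congr_fun (by
      intro k; simp [div_eq_inv_mul])
  have hR := ((hasSum_ite_eq (0 : ℕ) (1 : ℝ)).add (hasSum_ite_eq (1 : ℕ) (u * x))).add
    ((hs u).mul_left (x ^ 2))
  refine hasSum_le (fun k => ?_) (hs (u * x)) hR
  have hpos : 0 ≤ x ^ 2 * (u ^ k / (k.factorial : ℝ)) := by positivity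
  rcases k with _ | _ | k
  · simpa using hpos
  · simpa using hpos
  · have : (u * x) ^ (k + 2) ≤ x ^ 2 * u ^ (k + 2) := by
      rw [mul_pow, mul_comm, pow_add x, mul_comm (x ^ k)]
      exact mul_le_mul_of_nonneg_right
        (mul_le_of_le_one_right (by positivity) (pow_le_one₀ hx hx1)) (by positivity)
    simp only [Nat.succ_ne_zero, if_false, zero_add, add_eq_right, ← mul_div_assoc]
    gcongr

namespace SublinearSpace

variable {Ω : Type*} [MeasurableSpace Ω] {S : SublinearSpace Ω} {X : ℕ → Ω → ℝ}

/-- Upper extended negative dependence with the constant `K`. -/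
def UpperENDWith (S : SublinearSpace Ω) (K : ℝ) (X : ℕ → Ω → ℝ) : Prop :=
  ∀ g : ℕ → ℝ → ℝ, (∀ i, IsBddLip (g i)) → (∀ i x, 0 ≤ g i x) →
    (∀ i, Monotone (g i)) → ∀ n : ℕ, 1 ≤ n →
    S.E (fun ω => ∏ i ∈ Finset.range n, g i (X i ω)) ≤
      (K : EReal) * ∏ i ∈ Finset.range n, S.E (fun ω => g i (X i ω))

/-- The Chernoff bound for identically distributed upper extended negatively dependent
variables. -/
theorem V_le_sum_le (hX : ∀ n, X n ∈ S.H) (hid : ∀ n, S.SameDistrib (X n) (X 0))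
    {K : ℝ} (hK : 1 ≤ K) (hend : S.UpperENDWith K X)
    {w : ℝ → ℝ} (hw : IsBddLip w) (hmono : Monotone w) {t : ℝ} (ht : 0 ≤ t) (r : ℝ) (n : ℕ) :
    S.V {ω | n * r ≤ ∑ i ∈ Finset.range n, w (X i ω)} ≤
      ENNReal.ofReal (K * S.Er (fun ω => Real.exp (t * (w (X 0 ω) - r))) ^ n) := by
  rcases Nat.eq_zero_or_pos n with rfl | hn
  · refine (V_le_one _).trans ?_
    simpa using hK
  set g : ℝ → ℝ := fun x => Real.exp (t * (w x - r)) with hg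
  have hgL : IsBddLip g := ((hw.sub_const r).const_mul t).exp
  have hgm : Monotone g := fun x y hxy => by
    simp only [hg]; gcongr; exact hmono hxy
  have hgX : ∀ i, S.IsBddRV (fun ω => g (X i ω)) := fun i => hgL.isBddRV (hX i)
  have hprod := IsBddRV.prod (Finset.range n) fun i _ => hgX i
  refine (V_le_of_indicator_le hprod
    (fun ω => Finset.prod_nonneg fun i _ => (Real.exp_pos _).le) fun ω hω => ?_).trans
    (ENNReal.ofReal_le_ofReal ?_)
  · have hω' : n * r ≤ ∑ i ∈ Finset.range n, w (X i ω) := hω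
    simp only [hg]
    rw [← Real.exp_sum, ← Finset.mul_sum, Finset.sum_sub_distrib]
    apply Real.one_le_exp
    apply mul_nonneg ht
    simpa using hω'
  · have h := hend (fun _ => g) (fun _ => hgL) (fun _ _ => (Real.exp_pos _).le) (fun _ => hgm) n hn
    rw [← coe_prod_Er n fun i _ => hgX i, ← hprod.coe_Er, ← EReal.coe_mul,
      EReal.coe_le_coe_iff] at h
    refine h.trans_eq ?_
    rw [Finset.prod_congr rfl fun i _ => (hid i).Er_eq (hX i) (hX 0) hgL, Finset.prod_const,
      Finset.card_range]

/-- For bounded monotone transforms the upper deviations of the averages have exponentially small,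
hence summable, capacities. -/
theorem tsum_V_le_sum_ne_top (hX : ∀ n, X n ∈ S.H) (hid : ∀ n, S.SameDistrib (X n) (X 0))
    (hend : S.UpperEND X) {w : ℝ → ℝ} (hw : IsBddLip w) (hmono : Monotone w) {r : ℝ}
    (hr : S.Er (fun ω => w (X 0 ω)) < r) :
    ∑' n : ℕ, S.V {ω | n * r ≤ ∑ i ∈ Finset.range n, w (X i ω)} ≠ ⊤ := by
  obtain ⟨K, hK, hend⟩ := hend
  obtain ⟨C, hC, hwC, -⟩ := id hw
  set ε := r - S.Er (fun ω => w (X 0 ω)) with hε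
  have hε0 : 0 < ε := sub_pos.2 hr
  set D := C + |r| + ε with hD
  have hr0 := abs_nonneg r
  have hD0 : 0 < D := by positivity
  -- this `t` minimizes `1 - t * ε + (t * D) ^ 2`
  set t := ε / (2 * D ^ 2) with ht
  have ht0 : 0 < t := by positivity
  have hwX := hw.isBddRV (S := S) (hX 0)
  set ρ := S.Er (fun ω => Real.exp (t * (w (X 0 ω) - r))) with hρ
  have hρX : S.IsBddRV (fun ω => Real.exp (t * (w (X 0 ω) - r))) :=
    ((hw.sub_const r).const_mul t).exp.isBddRV (hX 0)
  have hρ0 : 0 ≤ ρ := Er_nonneg hρX fun ω => (Real.exp_pos _).le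
  have hρ1 : ρ < 1 := by
    have hpt : ∀ ω, Real.exp (t * (w (X 0 ω) - r)) ≤
        t * w (X 0 ω) + (1 - t * r + (t * D) ^ 2) := by
      intro ω
      set u := w (X 0 ω) - r with hu
      have hu1 : |u| ≤ D := by
        have := abs_sub (w (X 0 ω)) r
        have := hwC (X 0 ω)
        linarith
      have htD : t * D ≤ 1 := by
        rw [ht, div_mul_eq_mul_div, div_le_one (by positivity)]
        nlinarith
      have h1 : |t * u| ≤ t * D := by
        rw [abs_mul, abs_of_pos ht0]; gcongr
      have h2 := (abs_le.1 (Real.abs_exp_sub_one_sub_id_le (h1.trans htD))).2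
      have h3 : (t * u) ^ 2 ≤ (t * D) ^ 2 := sq_le_sq' (abs_le.1 h1).1 (abs_le.1 h1).2
      have : t * u = t * w (X 0 ω) - t * r := by rw [hu]; ring
      linarith
    have h := Er_mono hρX ((hwX.const_mul t).add (.const _)) hpt
    rw [Er_add_const (hwX.const_mul t), Er_const_mul hwX ht0.le] at h
    have h4 : (t * D) ^ 2 = t * ε / 2 := by
      rw [ht]; field_simp
    have h5 : 0 < t * ε := by positivity
    have h6 : t * ε = t * r - t * S.Er (fun ω => w (X 0 ω)) := by rw [hε]; ring
    linarith
  have hsum : Summable fun n : ℕ => K * ρ ^ n := (summable_geometric_of_lt_one hρ0 hρ1).mul_left K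
  exact ne_top_of_le_ne_top hsum.tsum_ofReal_ne_top
    (ENNReal.tsum_le_tsum fun n => V_le_sum_le hX hid hK hend hw hmono ht0.le r n)

/-! ### Large values along dyadic times -/

/-- The smoothed indicator of `{z ≥ 2 ^ j}`: it is `1` there and vanishes on
`{z ≤ 2 ^ j / 2}`. -/
noncomputable def dyadicBump (z : ℝ → ℝ) (j : ℕ) (x : ℝ) : ℝ :=
  max 0 (min (2 * z x / 2 ^ j - 1) 1)

theorem isBddLip_dyadicBump {z : ℝ → ℝ} {L : ℝ} (hz : ∀ x y, |z x - z y| ≤ L * |x - y|) (j : ℕ) :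
    IsBddLip (dyadicBump z j) := by
  refine .clamp (2 / 2 ^ j * L) (fun x y => ?_) 0 1 zero_le_one
  calc |2 * z x / 2 ^ j - 1 - (2 * z y / 2 ^ j - 1)| = |2 / 2 ^ j * (z x - z y)| := by ring_nf
    _ = 2 / 2 ^ j * |z x - z y| := by rw [abs_mul, abs_of_pos (by positivity)]
    _ ≤ 2 / 2 ^ j * (L * |x - y|) := by gcongr; exact hz x y
    _ = _ := by ring

theorem dyadicBump_nonneg (z : ℝ → ℝ) (j : ℕ) (x : ℝ) : 0 ≤ dyadicBump z j x := le_max_left _ _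

theorem dyadicBump_eq_one {z : ℝ → ℝ} {j : ℕ} {x : ℝ} (h : 2 ^ j ≤ z x) :
    dyadicBump z j x = 1 := by
  have : 1 ≤ 2 * z x / 2 ^ j - 1 := by
    have : (2 : ℝ) ≤ 2 * z x / 2 ^ j := by rw [le_div_iff₀ (by positivity)]; linarith
    linarith
  simp [dyadicBump, this]

theorem sq_min_le_sum_dyadicBump {z : ℝ → ℝ} {x : ℝ} (hz : 0 ≤ z x) (k : ℕ) :
    min (z x) (2 ^ k) ^ 2 ≤ 1 + ∑ j ∈ Finset.range k, 4 * 4 ^ j * dyadicBump z j x := by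
  induction k with
  | zero =>
    have h0 : 0 ≤ min (z x) 1 := le_min hz zero_le_one
    simpa using pow_le_one₀ (n := 2) h0 (min_le_right _ _)
  | succ k ih =>
    rw [Finset.sum_range_succ]
    rcases le_total (z x) (2 ^ k) with h | h
    · rw [min_eq_left h] at ih
      rw [min_eq_left (h.trans (pow_le_pow_right₀ one_le_two k.le_succ))]
      have : 0 ≤ 4 * 4 ^ k * dyadicBump z k x := mul_nonneg (by positivity) (dyadicBump_nonneg _ _ _)
      linarith
    · rw [dyadicBump_eq_one h]
      have h1 : 0 ≤ min (z x) (2 ^ (k + 1)) := le_min hz (by positivity)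
      have h2 : min (z x) (2 ^ (k + 1)) ^ 2 ≤ (2 ^ (k + 1)) ^ 2 :=
        pow_le_pow_left₀ h1 (min_le_right _ _) 2
      have h3 : ((2 : ℝ) ^ (k + 1)) ^ 2 = 4 * 4 ^ k := by
        rw [← pow_mul, mul_comm, pow_mul, pow_succ]; norm_num; ring
      have h4 : 0 ≤ ∑ j ∈ Finset.range k, 4 * 4 ^ j * dyadicBump z j x :=
        Finset.sum_nonneg fun j _ => mul_nonneg (by positivity) (dyadicBump_nonneg _ _ _)
      linarith

/-- A bound for `2 ^ (-k) * E[(z ∧ 2 ^ k) ^ 2]` in terms of the dyadic tails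
`v j`, written as a convolution of `2 ^ j * v j` with a geometric sequence. -/
noncomputable def dyadicMoment (v : ℕ → ℝ) (k : ℕ) : ℝ :=
  (1 / 2) ^ k + 4 * ∑ j ∈ Finset.range (k + 1), (2 ^ j * v j) * (1 / 2) ^ (k - j)

theorem summable_dyadicMoment {v : ℕ → ℝ}
    (hv : Summable fun j => 2 ^ j * v j) : Summable (dyadicMoment v) := by
  have hg : Summable fun i : ℕ => (1 / 2 : ℝ) ^ i := summable_geometric_two
  refine hg.add (Summable.mul_left 4 ?_)
  refine (summable_norm_sum_mul_range_of_summable_norm (f := fun j => 2 ^ j * v j)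
    (g := fun i => (1 / 2 : ℝ) ^ i) ?_ ?_).of_norm
  · exact hv.norm
  · exact hg.norm

theorem dyadicMoment_pos {v : ℕ → ℝ} (hv0 : ∀ j, 0 ≤ v j) (k : ℕ) : 0 < dyadicMoment v k := by
  have : 0 ≤ ∑ j ∈ Finset.range (k + 1), (2 ^ j * v j) * (1 / 2 : ℝ) ^ (k - j) :=
    Finset.sum_nonneg fun j _ => by have := hv0 j; positivity
  rw [dyadicMoment]; positivity

theorem two_pow_mul_dyadicMoment (v : ℕ → ℝ) (k : ℕ) :
    2 ^ k * dyadicMoment v k = 1 + ∑ j ∈ Finset.range (k + 1), 4 * 4 ^ j * v j := by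
  rw [dyadicMoment, mul_add, ← mul_pow, Finset.mul_sum, Finset.mul_sum]
  norm_num
  refine Finset.sum_congr rfl fun j hj => ?_
  have hj' : j ≤ k := by simpa [Nat.lt_succ_iff] using hj
  obtain ⟨i, rfl⟩ := Nat.exists_eq_add_of_le hj'
  have h2 : (2 : ℝ) ^ i * (1 / 2) ^ i = 1 := by rw [← mul_pow]; norm_num
  have h4 : (4 : ℝ) ^ j = 2 ^ j * 2 ^ j := by rw [← mul_pow]; norm_num
  rw [Nat.add_sub_cancel_left, pow_add, h4]
  have : (2 : ℝ) ^ j * 2 ^ i * (4 * (2 ^ j * v j * (1 / 2) ^ i)) =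
    4 * (2 ^ j * 2 ^ j) * v j * (2 ^ i * (1 / 2) ^ i) := by ring
  rw [h2] at this
  norm_num at this ⊢
  linarith

/-- The capacity that truncated sums exceed their mean level plus one. The exponent is chosen so
that `exp (t * 2 ^ k)` is the inverse of the second-moment bound `dyadicMoment`; the
quadratic term of the exponential moment then contributes only a bounded factor. -/
theorem V_le_truncated_sum_le (hX : ∀ n, X n ∈ S.H) (hid : ∀ n, S.SameDistrib (X n) (X 0))
    {K : ℝ} (hK : 1 ≤ K) (hend : S.UpperENDWith K X)
    {z : ℝ → ℝ} {L m : ℝ} (hz : ∀ x y, |z x - z y| ≤ L * |x - y|) (hz0 : ∀ x, 0 ≤ z x)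
    (hmono : Monotone z) (k : ℕ)
    (hm : S.Er (fun ω => max 0 (min (z (X 0 ω)) (2 ^ k))) ≤ m) :
    S.V {ω | ((2 ^ k : ℕ) : ℝ) * (m + 1) ≤
        ∑ i ∈ Finset.range (2 ^ k), max 0 (min (z (X i ω)) (2 ^ k))} ≤
      ENNReal.ofReal (K * (Real.exp 1 *
        dyadicMoment (fun j => S.Er fun ω => dyadicBump z j (X 0 ω)) k)) := by
  set v : ℕ → ℝ := fun j => S.Er fun ω => dyadicBump z j (X 0 ω) with hv
  have hbump : ∀ j, S.IsBddRV (fun ω => dyadicBump z j (X 0 ω)) := fun j =>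
    (isBddLip_dyadicBump hz j).isBddRV (hX 0)
  have hv0 : ∀ j, 0 ≤ v j := fun j => Er_nonneg (hbump j) fun ω => dyadicBump_nonneg _ _ _
  set β := dyadicMoment v k with hβ
  have hβ0 : 0 < β := dyadicMoment_pos hv0 k
  rcases le_or_gt 1 β with hβ1 | hβ1
  · refine (V_le_one _).trans ?_
    rw [← ENNReal.ofReal_one]
    refine ENNReal.ofReal_le_ofReal ?_
    have h1 : (1 : ℝ) ≤ Real.exp 1 := Real.one_le_exp zero_le_one
    exact one_le_mul_of_one_le_of_one_le hK (one_le_mul_of_one_le_of_one_le h1 hβ1)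
  set w : ℝ → ℝ := fun x => max 0 (min (z x) (2 ^ k)) with hw
  have hN : (0 : ℝ) < 2 ^ k := by positivity
  have hwL : IsBddLip w := .clamp L hz 0 _ hN.le
  have hwm : Monotone w := fun x y hxy => max_le_max le_rfl (min_le_min (hmono hxy) le_rfl)
  set t := -Real.log β / 2 ^ k with ht
  have ht0 : 0 ≤ t := div_nonneg (neg_nonneg.2 (Real.log_nonpos hβ0.le hβ1.le)) hN.le
  have htN : t * 2 ^ k = -Real.log β := by rw [ht]; field_simp
  have hexp : Real.exp (t * 2 ^ k) = β⁻¹ := by rw [htN, Real.exp_neg, Real.exp_log hβ0]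
  have hwX := hwL.isBddRV (S := S) (hX 0)
  have hgX : S.IsBddRV (fun ω => Real.exp (t * (w (X 0 ω) - (m + 1)))) :=
    ((hwL.sub_const _).const_mul t).exp.isBddRV (hX 0)
  have hE : S.Er (fun ω => Real.exp (t * (w (X 0 ω) - (m + 1)))) ≤ Real.exp (-t + 1 / 2 ^ k) := by
    have hpt : ∀ ω, Real.exp (t * (w (X 0 ω) - (m + 1))) ≤ Real.exp (-(t * (m + 1))) *
        ((t * w (X 0 ω) + (1 / (2 ^ k) ^ 2 * β⁻¹) *
          ∑ j ∈ Finset.range (k + 1), 4 * 4 ^ j * dyadicBump z j (X 0 ω)) +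
          (1 + 1 / (2 ^ k) ^ 2 * β⁻¹)) := by
      intro ω
      rw [mul_sub, sub_eq_add_neg, add_comm, Real.exp_add]
      gcongr
      have hw' : w (X 0 ω) = min (z (X 0 ω)) (2 ^ k) := max_eq_right (le_min (hz0 _) hN.le)
      have hw0 : 0 ≤ w (X 0 ω) := le_max_left _ _
      have hwN : w (X 0 ω) ≤ 2 ^ k := hw' ▸ min_le_right _ _
      have h1 := exp_mul_le_of_le_one (u := t * 2 ^ k) (x := w (X 0 ω) / 2 ^ k) (by positivity)
        (by positivity) ((div_le_one hN).2 hwN)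
      have h2 : t * 2 ^ k * (w (X 0 ω) / 2 ^ k) = t * w (X 0 ω) := by field_simp
      rw [h2, hexp] at h1
      have h3 : w (X 0 ω) ^ 2 ≤
          1 + ∑ j ∈ Finset.range (k + 1), 4 * 4 ^ j * dyadicBump z j (X 0 ω) := by
        rw [hw', Finset.sum_range_succ]
        have := sq_min_le_sum_dyadicBump (hz0 (X 0 ω)) k
        have : 0 ≤ 4 * 4 ^ k * dyadicBump z k (X 0 ω) :=
          mul_nonneg (by positivity) (dyadicBump_nonneg _ _ _)
        linarith
      have h4 : (w (X 0 ω) / 2 ^ k) ^ 2 * β⁻¹ ≤ (1 / (2 ^ k) ^ 2 * β⁻¹) *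
          (1 + ∑ j ∈ Finset.range (k + 1), 4 * 4 ^ j * dyadicBump z j (X 0 ω)) := by
        rw [div_pow, div_eq_mul_one_div, mul_assoc, mul_comm]
        gcongr
      linarith
    have hsumX : S.IsBddRV fun ω =>
        ∑ j ∈ Finset.range (k + 1), 4 * 4 ^ j * dyadicBump z j (X 0 ω) :=
      .sum _ fun j _ => (hbump j).const_mul _
    have hb0 : 0 ≤ 1 / (2 ^ k) ^ 2 * β⁻¹ := by positivity
    have hin := (hwX.const_mul t).add (hsumX.const_mul (1 / (2 ^ k) ^ 2 * β⁻¹))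
    have h := Er_mono hgX ((hin.add (.const _)).const_mul _) hpt
    rw [Er_const_mul (hin.add (.const _)) (Real.exp_pos _).le, Er_add_const hin] at h
    have h1 := Er_add_le (hwX.const_mul t) (hsumX.const_mul (1 / (2 ^ k) ^ 2 * β⁻¹))
    rw [Er_const_mul hwX ht0, Er_const_mul hsumX hb0] at h1
    have h2 : S.Er (fun ω => ∑ j ∈ Finset.range (k + 1), 4 * 4 ^ j * dyadicBump z j (X 0 ω)) ≤
        ∑ j ∈ Finset.range (k + 1), 4 * 4 ^ j * v j := by
      refine (Er_sum_le _ fun j _ => (hbump j).const_mul _).trans_eq ?_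
      exact Finset.sum_congr rfl fun j _ => Er_const_mul (hbump j) (by positivity)
    have h3 := two_pow_mul_dyadicMoment v k
    have h4 : t * S.Er (fun ω => w (X 0 ω)) ≤ t * m := mul_le_mul_of_nonneg_left hm ht0
    have h5 := mul_le_mul_of_nonneg_left h2 hb0
    have h6 : (1 / (2 ^ k) ^ 2 * β⁻¹) * (2 ^ k * β) = 1 / 2 ^ k := by field_simp
    have h7 : (1 / (2 ^ k) ^ 2 * β⁻¹) * (2 ^ k * β) =
        1 / (2 ^ k) ^ 2 * β⁻¹ +
          (1 / (2 ^ k) ^ 2 * β⁻¹) * ∑ j ∈ Finset.range (k + 1), 4 * 4 ^ j * v j := by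
      rw [h3]; ring
    calc _ ≤ _ := h
      _ ≤ Real.exp (-(t * (m + 1))) * (t * m + 1 / 2 ^ k + 1) := by
        refine mul_le_mul_of_nonneg_left ?_ (Real.exp_pos _).le
        linarith
      _ ≤ Real.exp (-(t * (m + 1))) * Real.exp (t * m + 1 / 2 ^ k) := by
        gcongr; exact Real.add_one_le_exp _
      _ = _ := by rw [← Real.exp_add]; ring_nf
  refine (V_le_sum_le hX hid hK hend hwL hwm ht0 (m + 1) (2 ^ k)).trans
    (ENNReal.ofReal_le_ofReal ?_)
  have hE0 := Er_nonneg hgX fun ω => (Real.exp_pos _).le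
  gcongr
  calc _ ≤ Real.exp (-t + 1 / 2 ^ k) ^ (2 ^ k) := by gcongr
    _ = Real.exp 1 * β := by
      rw [← Real.exp_nat_mul]
      have : ((2 ^ k : ℕ) : ℝ) * (-t + 1 / 2 ^ k) = 1 + Real.log β := by
        push_cast
        have : (2 : ℝ) ^ k * (1 / 2 ^ k) = 1 := by field_simp
        linarith
      rw [this, Real.exp_add, Real.exp_log hβ0]

/-- Along dyadic times the sums of the full variables obey the same bound as the truncated ones,
since the capacities of the events that truncation changes a summand are summable. -/
theorem tsum_V_le_dyadic_sum_ne_top (hX : ∀ n, X n ∈ S.H)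
    (hid : ∀ n, S.SameDistrib (X n) (X 0)) (hend : S.UpperEND X)
    {z : ℝ → ℝ} {L m : ℝ} (hz : ∀ x y, |z x - z y| ≤ L * |x - y|) (hz0 : ∀ x, 0 ≤ z x)
    (hmono : Monotone z)
    (hm : ∀ k : ℕ, S.Er (fun ω => max 0 (min (z (X 0 ω)) (2 ^ k))) ≤ m)
    (hV : ∑' j : ℕ, 2 ^ j * S.V {ω | 2 ^ j ≤ 2 * z (X 0 ω)} ≠ ⊤) :
    ∑' k : ℕ, S.V {ω | ((2 ^ k : ℕ) : ℝ) * (m + 1) ≤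
      ∑ i ∈ Finset.range (2 ^ k), z (X i ω)} ≠ ⊤ := by
  obtain ⟨K, hK, hend⟩ := hend
  set v : ℕ → ℝ := fun j => S.Er fun ω => dyadicBump z j (X 0 ω) with hv
  have hbump : ∀ i j, S.IsBddRV (fun ω => dyadicBump z j (X i ω)) := fun i j =>
    (isBddLip_dyadicBump hz j).isBddRV (hX i)
  have hv0 : ∀ j, 0 ≤ v j := fun j => Er_nonneg (hbump 0 j) fun ω => dyadicBump_nonneg _ _ _
  have hvV : ∀ j, ENNReal.ofReal (v j) ≤ S.V {ω | 2 ^ j ≤ 2 * z (X 0 ω)} := by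
    intro j
    refine Er_le_V (hbump 0 j) (fun ω hω => ?_) fun ω => max_le zero_le_one (min_le_right _ _)
    have hω' : 2 * z (X 0 ω) < 2 ^ j := by simpa using hω
    refine max_le le_rfl ((min_le_left _ _).trans ?_)
    rw [sub_nonpos, div_le_one (by positivity)]
    exact hω'.le
  have hvs : Summable fun j => 2 ^ j * v j := by
    have h2 : ∀ j : ℕ, (2 : ℝ≥0∞) ^ j = ENNReal.ofReal (2 ^ j) := fun j => by
      rw [ENNReal.ofReal_pow zero_le_two]; simp
    have h : ∑' j : ℕ, ENNReal.ofReal (2 ^ j * v j) ≠ ⊤ := by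
      refine ne_top_of_le_ne_top hV (ENNReal.tsum_le_tsum fun j => ?_)
      rw [ENNReal.ofReal_mul (by positivity), h2]
      gcongr
      exact hvV j
    refine (ENNReal.summable_toReal h).congr fun j => ?_
    rw [ENNReal.toReal_ofReal (mul_nonneg (by positivity) (hv0 j))]
  have hsum := (((summable_dyadicMoment hvs).mul_left (Real.exp 1)).mul_left K).add hvs
  refine ne_top_of_le_ne_top hsum.tsum_ofReal_ne_top (ENNReal.tsum_le_tsum fun k => ?_)
  have hsub : {ω | ((2 ^ k : ℕ) : ℝ) * (m + 1) ≤ ∑ i ∈ Finset.range (2 ^ k), z (X i ω)} ⊆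
      {ω | ((2 ^ k : ℕ) : ℝ) * (m + 1) ≤
        ∑ i ∈ Finset.range (2 ^ k), max 0 (min (z (X i ω)) (2 ^ k))} ∪
      ⋃ i ∈ Finset.range (2 ^ k), {ω | 2 ^ k < z (X i ω)} := by
    intro ω hω
    by_cases h : ∃ i ∈ Finset.range (2 ^ k), 2 ^ k < z (X i ω)
    · right
      obtain ⟨i, hi, h⟩ := h
      exact Set.mem_biUnion hi h
    · left
      push Not at h
      have hω' : ((2 ^ k : ℕ) : ℝ) * (m + 1) ≤ ∑ i ∈ Finset.range (2 ^ k), z (X i ω) := hω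
      refine hω'.trans_eq (Finset.sum_congr rfl fun i hi => ?_)
      rw [min_eq_left (h i hi), max_eq_right (hz0 _)]
  have hpos : 0 ≤ K * (Real.exp 1 * dyadicMoment v k) := by
    have := dyadicMoment_pos hv0 k
    positivity
  calc _ ≤ _ := V_mono hsub
    _ ≤ _ := V_union_le _ _
    _ ≤ ENNReal.ofReal (K * (Real.exp 1 * dyadicMoment v k)) +
        ∑ i ∈ Finset.range (2 ^ k), ENNReal.ofReal (v k) := by
      refine add_le_add (V_le_truncated_sum_le hX hid hK hend hz hz0 hmono k (hm k))
        ((V_biUnion_le _ _).trans (Finset.sum_le_sum fun i _ => ?_))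
      refine (V_le_of_indicator_le (hbump i k) (fun ω => dyadicBump_nonneg _ _ _)
        fun ω hω => (dyadicBump_eq_one (le_of_lt hω)).ge).trans_eq ?_
      rw [(hid i).Er_eq (hX i) (hX 0) (isBddLip_dyadicBump hz k)]
    _ = _ := by
      rw [ENNReal.ofReal_add hpos (mul_nonneg (by positivity) (hv0 k))]
      congr 1
      rw [Finset.sum_const, Finset.card_range, nsmul_eq_mul, ENNReal.ofReal_mul (by positivity),
        ENNReal.ofReal_pow zero_le_two]
      simp

end SublinearSpace

namespace SublinearSpace

variable {Ω : Type*} [MeasurableSpace Ω] {S : SublinearSpace Ω} {X : ℕ → Ω → ℝ}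

/-! ### The upper law of large numbers -/

/-- A finite Choquet integral makes the dyadic tail sums finite. -/
theorem tsum_two_pow_mul_V_ne_top {Y : Ω → ℝ} (hY : choquet S.V Y < ⊤) {s : ℝ} (hs : 0 < s) :
    ∑' j : ℕ, 2 ^ j * S.V {ω | s * 2 ^ j ≤ Y ω} ≠ ⊤ := by
  set f : ℕ → ℝ := fun n => s / 2 * 2 ^ n with hf
  have hfm : Monotone f := fun a b hab => by
    simp only [hf]; gcongr; exact one_le_two
  have hle : ∑' j : ℕ, ENNReal.ofReal (s / 2) * (2 ^ j * S.V {ω | s * 2 ^ j ≤ Y ω}) ≤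
      choquet S.V Y := by
    calc _ ≤ ∑' j : ℕ, ∫⁻ t in Set.Ioc (f j) (f (Order.succ j)), S.V {ω | t ≤ Y ω} := by
          refine ENNReal.tsum_le_tsum fun j => ?_
          have h1 : f (Order.succ j) = s * 2 ^ j := by
            simp only [hf, Nat.succ_eq_succ, Nat.succ_eq_add_one, pow_succ]; ring
          have h2 : f (Order.succ j) - f j = s / 2 * 2 ^ j := by rw [h1]; simp only [hf]; ring
          calc ENNReal.ofReal (s / 2) * (2 ^ j * S.V {ω | s * 2 ^ j ≤ Y ω})
              = ∫⁻ _ in Set.Ioc (f j) (f (Order.succ j)), S.V {ω | s * 2 ^ j ≤ Y ω} := by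
                rw [setLIntegral_const, Real.volume_Ioc, h2, ENNReal.ofReal_mul (by positivity),
                  ENNReal.ofReal_pow zero_le_two]
                simp only [ENNReal.ofReal_ofNat]
                ring
            _ ≤ _ := by
                refine setLIntegral_mono' measurableSet_Ioc fun t ht => V_mono fun ω hω => ?_
                have hω' : s * 2 ^ j ≤ Y ω := hω
                exact (ht.2.trans_eq h1).trans hω'
      _ = ∫⁻ t in ⋃ j : ℕ, Set.Ioc (f j) (f (Order.succ j)), S.V {ω | t ≤ Y ω} :=
          (lintegral_iUnion (fun _ => measurableSet_Ioc) hfm.pairwise_disjoint_on_Ioc_succ _).symm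
      _ ≤ _ := by
          refine lintegral_mono_set (Set.iUnion_subset fun j t ht => ?_)
          exact lt_trans (by simp only [hf]; positivity) ht.1
  rw [ENNReal.tsum_mul_left] at hle
  intro htop
  rw [htop, ENNReal.mul_top (by simpa using hs)] at hle
  exact absurd hY (not_lt.2 hle)

/-- Partial sums of non-negative numbers are controlled at all times by their values at
dyadic times. -/
theorem eventually_sum_le_of_dyadic {a : ℕ → ℝ} (ha : ∀ i, 0 ≤ a i) {M : ℝ} (hM : 0 ≤ M)
    (h : ∀ᶠ k in atTop, ∑ i ∈ Finset.range (2 ^ k), a i ≤ ((2 ^ k : ℕ) : ℝ) * M) :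
    ∀ᶠ n : ℕ in atTop, ∑ i ∈ Finset.range n, a i ≤ 2 * n * M := by
  obtain ⟨k₀, hk₀⟩ := eventually_atTop.1 h
  filter_upwards [eventually_ge_atTop (2 ^ k₀)] with n hn
  have hn0 : n ≠ 0 := (lt_of_lt_of_le (by positivity) hn).ne'
  have h1 : n < 2 ^ (Nat.log 2 n + 1) := Nat.lt_pow_succ_log_self one_lt_two n
  have h2 : 2 ^ Nat.log 2 n ≤ n := Nat.pow_log_le_self 2 hn0
  have h3 : k₀ ≤ Nat.log 2 n + 1 := (Nat.le_log_of_pow_le one_lt_two hn).trans (Nat.le_succ _)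
  calc ∑ i ∈ Finset.range n, a i ≤ ∑ i ∈ Finset.range (2 ^ (Nat.log 2 n + 1)), a i :=
        Finset.sum_le_sum_of_subset_of_nonneg (Finset.range_mono h1.le) fun i _ _ => ha i
    _ ≤ _ := hk₀ _ h3
    _ ≤ 2 * n * M := by
        refine mul_le_mul_of_nonneg_right ?_ hM
        rw [pow_succ]
        have : ((2 ^ Nat.log 2 n : ℕ) : ℝ) ≤ n := by exact_mod_cast h2
        push_cast at this ⊢
        linarith

theorem measurableSet_le_sum (hX : ∀ n, X n ∈ S.H) {z : ℝ → ℝ} (hz : Monotone z) (r : ℝ) (n : ℕ) :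
    MeasurableSet {ω | r ≤ ∑ i ∈ Finset.range n, z (X i ω)} := by
  refine measurableSet_le measurable_const (Finset.measurable_sum _ fun i _ => ?_)
  exact hz.measurable.comp (S.measurable_of_mem _ (hX i))

theorem max_abs_sub_mem {Y : Ω → ℝ} (hY : Y ∈ S.H) (c : ℝ) :
    (fun ω => max (|Y ω| - c) 0) ∈ S.H := by
  refine S.comp_mem_one (φ := fun x => max (x - c) 0) ⟨1, one_pos, 0, fun x y => ?_⟩ (S.abs_mem hY)
  have h1 : |max (x - c) 0 - max (y - c) 0| ≤ |x - y| := by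
    simpa using abs_max_sub_max_le_abs (x - c) (y - c) 0
  have := abs_nonneg (x - y)
  simp only [pow_zero, Real.norm_eq_abs]; linarith

theorem E_nonneg {Y : Ω → ℝ} (hY : Y ∈ S.H) (h : ∀ ω, 0 ≤ Y ω) : 0 ≤ S.E Y := by
  simpa [S.const] using S.mono _ hY _ (S.const_mem 0) h

/-- Uniform integrability makes the expectation finite. -/
theorem E_ne_top_and_ne_bot {Y : Ω → ℝ} (hY : Y ∈ S.H) {c : ℝ}
    (hc : S.E (fun ω => max (|Y ω| - c) 0) ≠ ⊤) : S.E Y ≠ ⊤ ∧ S.E Y ≠ ⊥ := by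
  have hq := max_abs_sub_mem hY c
  have hq0 := E_nonneg hq fun ω => le_max_right _ _
  have hqb : S.E (fun ω => max (|Y ω| - c) 0) ≠ ⊥ := ne_bot_of_le_ne_bot (by simp) hq0
  have h1 := S.subadd _ hq _ (S.const_mem c) (fun h => hc h.1) (fun h => hqb h.1)
  have hqc : (fun ω => max (|Y ω| - c) 0 + c) ∈ S.H := S.H.add_mem hq (S.const_mem c)
  have hlt : S.E (fun ω => max (|Y ω| - c) 0 + c) ≠ ⊤ := by
    refine ne_top_of_le_ne_top ?_ h1
    rw [S.const]
    exact EReal.add_ne_top hc (EReal.coe_ne_top c)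
  have habs : ∀ ω, |Y ω| ≤ max (|Y ω| - c) 0 + c := fun ω => by
    linarith [le_max_left (|Y ω| - c) 0]
  refine ⟨ne_top_of_le_ne_top hlt (S.mono _ hqc _ hY fun ω => (le_abs_self _).trans (habs ω)),
    fun hbot => ?_⟩
  have h2 := S.subadd _ hY _ hqc (fun h => by simp [hbot] at h) (fun h => hlt h.2)
  rw [hbot, EReal.bot_add] at h2
  have h3 := E_nonneg (S.H.add_mem hY hqc) fun ω => by
    have := habs ω
    have := neg_abs_le (Y ω)
    simp only [Pi.add_apply]; linarith
  exact absurd (h3.trans h2) (by simp)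

/-- Outside a null set the averages eventually stay below each level above the mean: the variables
are split into a bounded part, governed by an exponential bound, and the excess over a high
level, which is controlled along dyadic times. -/
theorem outerV_not_eventually_le (hX : ∀ n, X n ∈ S.H) (hid : ∀ n, S.SameDistrib (X n) (X 0))
    (hui : Tendsto (fun c : ℝ => S.E (fun ω => max (|X 0 ω| - c) 0)) atTop (𝓝 0))
    (hch : choquet S.V (fun ω => |X 0 ω|) < ⊤) (hend : S.UpperEND X) {ε : ℝ} (hε : 0 < ε) :
    S.outerV {ω | ¬ ∀ᶠ n : ℕ in atTop, partialSum X n ω ≤ n * ((S.E (X 0)).toReal + ε)} = 0 := by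
  obtain ⟨η, rfl⟩ : ∃ η, ε = 6 * η := ⟨ε / 6, by ring⟩
  have hη : 0 < η := by linarith
  have hev := hui.eventually (gt_mem_nhds (show (0 : EReal) < ((η : ℝ) : EReal) by exact_mod_cast hη))
  obtain ⟨c, hcη, hc1⟩ := (hev.and (eventually_ge_atTop (0 : ℝ))).exists
  set q : Ω → ℝ := fun ω => max (|X 0 ω| - c) 0 with hq
  have hqH : q ∈ S.H := max_abs_sub_mem (hX 0) c
  have hfin := E_ne_top_and_ne_bot (hX 0) (ne_top_of_lt hcη)
  set μ := (S.E (X 0)).toReal with hμ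
  have hμE : (μ : EReal) = S.E (X 0) := EReal.coe_toReal hfin.1 hfin.2
  -- the bounded part
  set w : ℝ → ℝ := fun x => max (-c) (min x c) with hw
  have hwL : IsBddLip w := .clamp 1 (fun x y => by simp) _ _ (by linarith)
  have hwm : Monotone w := fun x y hxy => max_le_max le_rfl (min_le_min hxy le_rfl)
  have hEw : S.Er (fun ω => w (X 0 ω)) < μ + 2 * η := by
    have h1 := S.mono _ (S.H.add_mem (hX 0) hqH) _ (hwL.isBddRV (hX 0)).1 fun ω => by
      simp only [hw, hq, Pi.add_apply]
      have h2 := le_max_left (|X 0 ω| - c) 0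
      have h3 := le_max_right (|X 0 ω| - c) 0
      have h4 := neg_abs_le (X 0 ω)
      exact max_le (by linarith) ((min_le_left _ _).trans (by linarith))
    have h2 := S.subadd _ (hX 0) _ hqH (fun h => hfin.1 h.1) (fun h => hfin.2 h.1)
    have h3 : S.E (X 0) + S.E q ≤ ((μ + η : ℝ) : EReal) := by
      rw [EReal.coe_add, hμE]; gcongr
    have h4 := h1.trans (h2.trans h3)
    rw [← (hwL.isBddRV (hX 0)).coe_Er, EReal.coe_le_coe_iff] at h4
    linarith
  -- the excess, scaled so that its truncated means are at most one
  set z : ℝ → ℝ := fun x => max (x - c) 0 / η with hz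
  have hzL : ∀ x y, |z x - z y| ≤ η⁻¹ * |x - y| := by
    intro x y
    have h1 : |max (x - c) 0 - max (y - c) 0| ≤ |x - y| := by
      simpa using abs_max_sub_max_le_abs (x - c) (y - c) 0
    simp only [hz]
    rw [← sub_div, abs_div, abs_of_pos hη, div_eq_inv_mul]
    gcongr
  have hz0 : ∀ x, 0 ≤ z x := fun x => div_nonneg (le_max_right _ _) hη.le
  have hzm : Monotone z := fun x y hxy => by
    simp only [hz]; gcongr
  have hm : ∀ k : ℕ, S.Er (fun ω => max 0 (min (z (X 0 ω)) (2 ^ k))) ≤ 1 := by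
    intro k
    have hL : IsBddLip (fun x => max 0 (min (z x) (2 ^ k))) := .clamp _ hzL _ _ (by positivity)
    have hB := hL.isBddRV (S := S) (hX 0)
    have h1 := S.mono _ hqH _ (hB.const_mul η).1 fun ω => by
      have h2 : max 0 (min (z (X 0 ω)) (2 ^ k)) ≤ z (X 0 ω) := max_le (hz0 _) (min_le_left _ _)
      have h3 : η * z (X 0 ω) = max (X 0 ω - c) 0 := by simp only [hz]; field_simp
      calc _ ≤ η * z (X 0 ω) := mul_le_mul_of_nonneg_left h2 hη.le
        _ ≤ q ω := by
          rw [h3]; exact max_le_max (by linarith [le_abs_self (X 0 ω)]) le_rfl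
    have h2 := h1.trans hcη.le
    rw [← (hB.const_mul η).coe_Er, EReal.coe_le_coe_iff, Er_const_mul hB hη.le] at h2
    nlinarith
  have hV : ∑' j : ℕ, 2 ^ j * S.V {ω | 2 ^ j ≤ 2 * z (X 0 ω)} ≠ ⊤ := by
    refine ne_top_of_le_ne_top (tsum_two_pow_mul_V_ne_top hch (s := η / 2) (by positivity))
      (ENNReal.tsum_le_tsum fun j => ?_)
    gcongr
    refine V_mono fun ω hω => ?_
    have hω' : 2 ^ j ≤ 2 * z (X 0 ω) := hω
    have h1 : max (X 0 ω - c) 0 ≤ |X 0 ω| := max_le (by linarith [le_abs_self (X 0 ω)]) (abs_nonneg _)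
    have h3 : η * z (X 0 ω) = max (X 0 ω - c) 0 := by simp only [hz]; field_simp
    change η / 2 * 2 ^ j ≤ |X 0 ω|
    nlinarith
  have hN1 := outerV_frequently_eq_zero
    (fun n => measurableSet_le_sum hX hwm (n * (μ + 2 * η)) n)
    (tsum_V_le_sum_ne_top hX hid hend hwL hwm hEw)
  have hN2 := outerV_frequently_eq_zero
    (fun k => measurableSet_le_sum hX hzm (((2 ^ k : ℕ) : ℝ) * (1 + 1)) (2 ^ k))
    (tsum_V_le_dyadic_sum_ne_top hX hid hend hzL hz0 hzm hm hV)
  rw [← outerMeasureV_apply] at hN1 hN2 ⊢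
  refine measure_mono_null ?_ (measure_union_null hN1 hN2)
  intro ω hω
  by_contra hcon
  simp only [Set.mem_union, Set.mem_ofPred_eq, not_or, not_frequently, not_le] at hcon
  obtain ⟨h1, h2⟩ := hcon
  refine hω ?_
  have h3 := eventually_sum_le_of_dyadic (a := fun i => z (X i ω)) (fun i => hz0 _)
    (M := 1 + 1) (by norm_num) (h2.mono fun k hk => hk.le)
  filter_upwards [h1, h3] with n hn1 hn3
  have hdec : ∀ i, X i ω ≤ w (X i ω) + η * z (X i ω) := by
    intro i
    have h4 : η * z (X i ω) = max (X i ω - c) 0 := by simp only [hz]; field_simp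
    rw [h4]
    rcases le_total (X i ω) c with h | h
    · simp [hw, h]
    · simp only [hw, min_eq_right h]
      linarith [le_max_left (X i ω - c) 0, le_max_right (-c) c]
  calc partialSum X n ω ≤ ∑ i ∈ Finset.range n, (w (X i ω) + η * z (X i ω)) :=
        Finset.sum_le_sum fun i _ => hdec i
    _ = ∑ i ∈ Finset.range n, w (X i ω) + η * ∑ i ∈ Finset.range n, z (X i ω) := by
        rw [Finset.sum_add_distrib, Finset.mul_sum]
    _ ≤ n * (μ + 2 * η) + η * (2 * n * (1 + 1)) :=
        add_le_add hn1.le (mul_le_mul_of_nonneg_left hn3 hη.le)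
    _ = n * (μ + 6 * η) := by ring

theorem outerV_upperEvent (hX : ∀ n, X n ∈ S.H) (hid : ∀ n, S.SameDistrib (X n) (X 0))
    (hui : Tendsto (fun c : ℝ => S.E (fun ω => max (|X 0 ω| - c) 0)) atTop (𝓝 0))
    (hch : choquet S.V (fun ω => |X 0 ω|) < ⊤) (hend : S.UpperEND X) :
    S.outerV (S.upperEvent X) = 0 := by
  have hfin : S.E (X 0) ≠ ⊤ ∧ S.E (X 0) ≠ ⊥ := by
    obtain ⟨c, hc⟩ := (hui.eventually (gt_mem_nhds (show (0 : EReal) < ⊤ by simp))).exists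
    exact E_ne_top_and_ne_bot (hX 0) hc.ne
  have hnull : ∀ p : ℕ, S.outerMeasureV
      {ω | ¬ ∀ᶠ n : ℕ in atTop, partialSum X n ω ≤
        n * ((S.E (X 0)).toReal + 1 / ((p : ℝ) + 1))} = 0 := fun p => by
    rw [outerMeasureV_apply]
    exact outerV_not_eventually_le hX hid hui hch hend Nat.one_div_pos_of_nat
  rw [← outerMeasureV_apply]
  refine measure_mono_null ?_ (measure_iUnion_null hnull)
  intro ω hω
  by_contra hcon
  simp only [Set.mem_iUnion, Set.mem_ofPred_eq, not_exists, not_not] at hcon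
  obtain ⟨b, hb1, hb2⟩ := EReal.lt_iff_exists_real_btwn.1 (show _ < _ from hω)
  rw [← EReal.coe_toReal hfin.1 hfin.2, EReal.coe_lt_coe_iff] at hb1
  obtain ⟨p, hp⟩ := exists_nat_one_div_lt (sub_pos.2 hb1)
  refine absurd hb2 (not_lt.2 (limsup_le_of_le (by isBoundedDefault) ?_))
  filter_upwards [hcon p, eventually_gt_atTop 0] with n hn hn0
  have hn0' : (0 : ℝ) < n := by exact_mod_cast hn0
  rw [EReal.coe_le_coe_iff, div_le_iff₀' hn0']
  refine hn.trans (mul_le_mul_of_nonneg_left ?_ hn0'.le)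
  linarith

/-! ### The lower law of large numbers, by reflection -/

theorem LowerEND.neg (h : S.LowerEND X) : S.UpperEND (fun n ω => -X n ω) := by
  obtain ⟨K, hK, h⟩ := h
  refine ⟨K, hK, fun g hg h0 hm n hn => ?_⟩
  exact h (fun i x => g i (-x)) (fun i => (hg i).comp_neg) (fun i x => h0 i _)
    (fun i x y hxy => hm i (neg_le_neg hxy)) n hn

theorem SameDistrib.neg {Y Z : Ω → ℝ} (h : S.SameDistrib Y Z) :
    S.SameDistrib (fun ω => -Y ω) (fun ω => -Z ω) := by
  intro φ hφ
  refine h (fun x => φ (-x)) ?_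
  obtain ⟨C, hC, m, hL⟩ := hφ
  refine ⟨C, hC, m, fun x y => (hL _ _).trans_eq ?_⟩
  rw [norm_neg, norm_neg, ← norm_neg (x - y)]
  ring_nf

theorem lowerEvent_eq : S.lowerEvent X = S.upperEvent (fun n ω => -X n ω) := by
  ext ω
  have h : (fun n : ℕ => ((partialSum (fun n ω => -X n ω) n ω / n : ℝ) : EReal)) =
      -fun n : ℕ => ((partialSum X n ω / n : ℝ) : EReal) := by
    ext n
    simp [partialSum, neg_div, EReal.coe_neg]
  simp only [lowerEvent, upperEvent, conjE, Set.mem_ofPred_eq]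
  rw [h, EReal.limsup_neg, EReal.lt_neg_comm]

theorem outerV_lowerEvent_union_upperEvent (hX : ∀ n, X n ∈ S.H)
    (hid : ∀ n, S.SameDistrib (X n) (X 0))
    (hui : Tendsto (fun c : ℝ => S.E (fun ω => max (|X 0 ω| - c) 0)) atTop (𝓝 0))
    (hch : choquet S.V (fun ω => |X 0 ω|) < ⊤) (hend : S.END X) :
    S.outerV (S.lowerEvent X ∪ S.upperEvent X) = 0 := by
  have h1 := outerV_upperEvent hX hid hui hch hend.1
  have h2 : S.outerV (S.lowerEvent X) = 0 := by
    rw [lowerEvent_eq]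
    exact outerV_upperEvent (X := fun n ω => -X n ω) (fun n => S.H.neg_mem (hX n))
      (fun n => (hid n).neg) (by simpa using hui) (by simpa using hch) hend.2.neg
  rw [← outerMeasureV_apply] at h1 h2 ⊢
  exact measure_union_null h2 h1

theorem measurable_partialSum (hX : ∀ n, X n ∈ S.H) (n : ℕ) : Measurable (partialSum X n) :=
  Finset.measurable_sum _ fun i _ => S.measurable_of_mem _ (hX i)

theorem measurableSet_upperEvent (hX : ∀ n, X n ∈ S.H) : MeasurableSet (S.upperEvent X) :=
  measurableSet_lt measurable_const
    (.limsup fun n => ((measurable_partialSum hX n).div_const _).coe_real_ereal)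

theorem measurableSet_lowerEvent (hX : ∀ n, X n ∈ S.H) : MeasurableSet (S.lowerEvent X) :=
  lowerEvent_eq (S := S) (X := X) ▸ measurableSet_upperEvent fun n => S.H.neg_mem (hX n)

end SublinearSpace

/-! ### Partial sums and their increments -/

/-- The averages are unbounded along any path where the quotients `|X i| / (i + 1)` are, since
`X i` is the difference of two consecutive partial sums. -/
theorem limsup_abs_partialSum_div_eq_top {Ω : Type*} {X : ℕ → Ω → ℝ} {ω : Ω}
    (h : ∀ M : ℕ, ∃ᶠ i : ℕ in atTop, ((M : ℝ) + 1) * (i + 1) < |X i ω|) :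
    limsup (fun n : ℕ => ((|partialSum X n ω| / n : ℝ) : EReal)) atTop = ⊤ := by
  by_contra hne
  obtain ⟨b, hb, -⟩ := EReal.lt_iff_exists_real_btwn.1 (lt_top_iff_ne_top.2 hne)
  have hev := eventually_lt_of_limsup_lt hb
  have hev' : ∀ᶠ n : ℕ in atTop, |partialSum X n ω| ≤ |b| * n := by
    filter_upwards [hev, eventually_gt_atTop 0] with n hn hn0
    have hn0' : (0 : ℝ) < n := by exact_mod_cast hn0
    rw [EReal.coe_lt_coe_iff, div_lt_iff₀ hn0'] at hn
    exact hn.le.trans (by gcongr; exact le_abs_self b)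
  obtain ⟨M, hM⟩ := exists_nat_ge (2 * |b|)
  obtain ⟨i, hi, h1, h2⟩ := ((h M).and_eventually
    (hev'.and ((tendsto_add_atTop_nat 1).eventually hev'))).exists
  have hXi : X i ω = partialSum X (i + 1) ω - partialSum X i ω := by
    simp [partialSum, Finset.sum_range_succ]
  have h3 : |X i ω| ≤ |partialSum X (i + 1) ω| + |partialSum X i ω| := by
    rw [hXi]; exact abs_sub _ _
  push_cast at h2
  have h4 : 2 * |b| * ((i : ℝ) + 1) ≤ M * (i + 1) := by gcongr
  have h5 : (0 : ℝ) ≤ i := Nat.cast_nonneg i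
  have := abs_nonneg b
  nlinarith

namespace SublinearSpace

variable {Ω : Type*} [MeasurableSpace Ω] {S : SublinearSpace Ω} {X : ℕ → Ω → ℝ}

/-! ### A second Borel–Cantelli lemma for extended independent variables -/

theorem ExtIndep.Er_prod (h : S.ExtIndep X) (hX : ∀ n, X n ∈ S.H) {ψ : ℕ → ℝ → ℝ}
    (hψ : ∀ i, IsBddLip (ψ i)) (h0 : ∀ i x, 0 ≤ ψ i x) {n : ℕ} (hn : 2 ≤ n) :
    S.Er (fun ω => ∏ i ∈ Finset.range n, ψ i (X i ω)) =
      ∏ i ∈ Finset.range n, S.Er (fun ω => ψ i (X i ω)) := by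
  have hB : ∀ i, S.IsBddRV (fun ω => ψ i (X i ω)) := fun i => (hψ i).isBddRV (hX i)
  have := h n hn ψ (fun i => (hψ i).isLocLip) h0 fun i _ => lt_top_iff_ne_top.2 (hB i).ne_top
  rw [← coe_prod_Er n fun i _ => hB i, ← (IsBddRV.prod _ fun i _ => hB i).coe_Er,
    EReal.coe_eq_coe_iff] at this
  exact this

/-- A second-moment bound. Products of `1 + b i * g i (X i)`, normalized to have mean one, have
second moment at most `exp (∑ b i ^ 2 * p i)` and are at most `(1 + ∑ b i * p i)⁻¹` where all
factors are trivial. -/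
theorem le_V_exists_pos (hX : ∀ n, X n ∈ S.H) (hind : S.ExtIndep X) {g : ℕ → ℝ → ℝ}
    (hg : ∀ i, IsBddLip (g i)) (hg0 : ∀ i x, 0 ≤ g i x) (hg1 : ∀ i x, g i x ≤ 1) {b : ℕ → ℝ}
    (hb : ∀ i, 0 ≤ b i) {n : ℕ} (hn : 2 ≤ n) :
    ENNReal.ofReal (2 - 2 * (1 + ∑ i ∈ Finset.range n, b i * S.Er (fun ω => g i (X i ω)))⁻¹ -
        Real.exp (∑ i ∈ Finset.range n, b i ^ 2 * S.Er (fun ω => g i (X i ω)))) ≤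
      S.V {ω | ∃ i ∈ Finset.range n, 0 < b i * g i (X i ω)} := by
  set p : ℕ → ℝ := fun i => S.Er (fun ω => g i (X i ω)) with hp
  have hgX : ∀ i, S.IsBddRV (fun ω => g i (X i ω)) := fun i => (hg i).isBddRV (hX i)
  have hp0 : ∀ i, 0 ≤ p i := fun i => Er_nonneg (hgX i) fun ω => hg0 i _
  have hbp : ∀ i, 0 ≤ b i * p i := fun i => mul_nonneg (hb i) (hp0 i)
  have hpos : ∀ i, 0 < 1 + b i * p i := fun i => by linarith [hbp i]
  set ψ : ℕ → ℝ → ℝ := fun i x => (1 + b i * p i)⁻¹ * (b i * g i x + 1) with hψ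
  have hψL : ∀ i, IsBddLip (ψ i) := fun i => (((hg i).const_mul _).add (.const 1)).const_mul _
  have hψ0 : ∀ i x, 0 ≤ ψ i x := fun i x =>
    mul_nonneg (inv_nonneg.2 (hpos i).le) (by linarith [mul_nonneg (hb i) (hg0 i x)])
  have hψX : ∀ i, S.IsBddRV (fun ω => ψ i (X i ω)) := fun i => (hψL i).isBddRV (hX i)
  have hEψ : ∀ i, S.Er (fun ω => ψ i (X i ω)) = 1 := by
    intro i
    have h1 := (hgX i).const_mul (b i)
    simp only [hψ]
    rw [Er_const_mul (h1.add (.const 1)) (inv_nonneg.2 (hpos i).le), Er_add_const h1,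
      Er_const_mul (hgX i) (hb i), add_comm (b i * _)]
    exact inv_mul_cancel₀ (hpos i).ne'
  have hEψ2 : ∀ i, S.Er (fun ω => ψ i (X i ω) * ψ i (X i ω)) ≤ Real.exp (b i ^ 2 * p i) := by
    intro i
    have hpt : ∀ ω, ψ i (X i ω) * ψ i (X i ω) ≤
        ((1 + b i * p i)⁻¹ ^ 2) * ((2 * b i + b i ^ 2) * g i (X i ω) + 1) := by
      intro ω
      have h1 : g i (X i ω) * g i (X i ω) ≤ g i (X i ω) :=
        mul_le_of_le_one_left (hg0 i _) (hg1 i _)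
      have h2 := mul_le_mul_of_nonneg_left h1 (sq_nonneg (b i))
      have h3 : ψ i (X i ω) * ψ i (X i ω) =
        ((1 + b i * p i)⁻¹ ^ 2) * (b i * g i (X i ω) + 1) ^ 2 := by simp only [hψ]; ring
      rw [h3]
      refine mul_le_mul_of_nonneg_left ?_ (sq_nonneg _)
      nlinarith
    have hb2 : 0 ≤ 2 * b i + b i ^ 2 := by have := hb i; positivity
    have h1 := (hgX i).const_mul (2 * b i + b i ^ 2)
    have h := Er_mono ((hψX i).mul (hψX i)) ((h1.add (.const 1)).const_mul _) hpt
    rw [Er_const_mul (h1.add (.const 1)) (sq_nonneg _), Er_add_const h1,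
      Er_const_mul (hgX i) hb2] at h
    refine h.trans (le_trans ?_ (Real.add_one_le_exp _))
    rw [inv_pow, inv_mul_le_iff₀ (pow_pos (hpos i) 2)]
    have h4 : 0 ≤ b i ^ 2 * p i := mul_nonneg (sq_nonneg _) (hp0 i)
    change (2 * b i + b i ^ 2) * p i + 1 ≤ _
    nlinarith [mul_nonneg h4 (hbp i), mul_nonneg h4 (sq_nonneg (b i * p i)), sq_nonneg (b i * p i)]
  set W : Ω → ℝ := fun ω => ∏ i ∈ Finset.range n, ψ i (X i ω) with hW
  have hWX : S.IsBddRV W := .prod _ fun i _ => hψX i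
  have hEW : S.Er W = 1 := by
    rw [hW, hind.Er_prod hX hψL hψ0 hn]; exact Finset.prod_eq_one fun i _ => hEψ i
  have hEW2 : S.Er (fun ω => W ω * W ω) ≤ Real.exp (∑ i ∈ Finset.range n, b i ^ 2 * p i) := by
    have h1 : (fun ω => W ω * W ω) =
        fun ω => ∏ i ∈ Finset.range n, ψ i (X i ω) * ψ i (X i ω) := by
      ext ω; rw [hW, Finset.prod_mul_distrib]
    rw [h1, hind.Er_prod (ψ := fun i x => ψ i x * ψ i x) hX (fun i => (hψL i).mul (hψL i))
      (fun i x => mul_self_nonneg _) hn, Real.exp_sum]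
    exact Finset.prod_le_prod (fun i _ => Er_nonneg ((hψX i).mul (hψX i))
      fun ω => mul_self_nonneg _) fun i _ => hEψ2 i
  have hsum : ∀ k : ℕ, 1 + ∑ i ∈ Finset.range k, b i * p i ≤
      ∏ i ∈ Finset.range k, (1 + b i * p i) := by
    intro k
    induction k with
    | zero => simp
    | succ k ih =>
      rw [Finset.sum_range_succ, Finset.prod_range_succ]
      have h0 : 0 ≤ ∑ i ∈ Finset.range k, b i * p i := Finset.sum_nonneg fun i _ => hbp i
      nlinarith [mul_le_mul_of_nonneg_right ih (hpos k).le, mul_nonneg h0 (hbp k)]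
  set θ := (1 + ∑ i ∈ Finset.range n, b i * p i)⁻¹ with hθ
  have hs0 : 0 < 1 + ∑ i ∈ Finset.range n, b i * p i := by
    have : 0 ≤ ∑ i ∈ Finset.range n, b i * p i := Finset.sum_nonneg fun i _ => hbp i
    linarith
  have hθ0 : 0 < θ := inv_pos.2 hs0
  refine le_V fun ξ hξ hξ0 _ hξA => ?_
  have hpt : ∀ ω, W ω ≤ (1 / 2 * (W ω * W ω) + 1 / 2 * ξ ω) + θ := by
    intro ω
    by_cases hω : ∃ i ∈ Finset.range n, 0 < b i * g i (X i ω)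
    · rw [hξA ω hω]
      nlinarith [sq_nonneg (W ω - 1)]
    · push Not at hω
      have h1 : W ω = (∏ i ∈ Finset.range n, (1 + b i * p i))⁻¹ := by
        rw [← Finset.prod_inv_distrib]
        refine Finset.prod_congr rfl fun i hi => ?_
        have : b i * g i (X i ω) = 0 := le_antisymm (hω i hi) (mul_nonneg (hb i) (hg0 i _))
        simp [hψ, this]
      have h2 : W ω ≤ θ := by rw [h1]; exact inv_anti₀ hs0 (hsum n)
      nlinarith [mul_self_nonneg (W ω), hξ0 ω]
  have h1 := (hWX.mul hWX).const_mul (1 / 2)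
  have h2 := hξ.const_mul (1 / 2)
  have h := Er_mono hWX ((h1.add h2).add (.const θ)) hpt
  rw [Er_add_const (h1.add h2), hEW] at h
  have h3 := Er_add_le h1 h2
  rw [Er_const_mul (hWX.mul hWX) (by norm_num), Er_const_mul hξ (by norm_num)] at h3
  linarith

/-- If the expectations of `g i (X i)` have a divergent sum, then infinitely many of these
variables are positive on a set of full capacity. -/
theorem V_frequently_pos_eq_one (hX : ∀ n, X n ∈ S.H) (hind : S.ExtIndep X)
    (hV : IsContinuousCapacity S.V) {g : ℕ → ℝ → ℝ}
    (hg : ∀ i, IsBddLip (g i)) (hg0 : ∀ i x, 0 ≤ g i x) (hg1 : ∀ i x, g i x ≤ 1)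
    (hmeas : ∀ i, MeasurableSet {ω | 0 < g i (X i ω)})
    (hp : ¬ Summable fun i => S.Er (fun ω => g i (X i ω))) :
    S.V {ω | ∃ᶠ i in atTop, 0 < g i (X i ω)} = 1 := by
  set p : ℕ → ℝ := fun i => S.Er (fun ω => g i (X i ω)) with hpdef
  have hp0 : ∀ i, 0 ≤ p i := fun i => Er_nonneg ((hg i).isBddRV (hX i)) fun ω => hg0 i _
  set U : ℕ → Set Ω := fun m => {ω | ∃ i ≥ m, 0 < g i (X i ω)} with hU
  have hU1 : ∀ m, S.V (U m) = 1 := by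
    intro m
    refine le_antisymm (V_le_one _) ?_
    have hlim : Tendsto (fun δ : ℝ => ENNReal.ofReal (2 - 2 * δ - Real.exp (δ ^ 2)))
        (𝓝[>] 0) (𝓝 1) := by
      have hc : Continuous fun δ : ℝ => ENNReal.ofReal (2 - 2 * δ - Real.exp (δ ^ 2)) :=
        ENNReal.continuous_ofReal.comp (by fun_prop)
      have := hc.tendsto 0
      norm_num at this
      exact this.mono_left nhdsWithin_le_nhds
    refine le_of_tendsto hlim ?_
    filter_upwards [self_mem_nhdsWithin] with δ hδ
    have hδ0 : (0 : ℝ) < δ := hδ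
    have htop := (not_summable_iff_tendsto_nat_atTop_of_nonneg hp0).1 hp
    obtain ⟨n, hn, hn2⟩ := ((htop.eventually_ge_atTop
      (∑ i ∈ Finset.range m, p i + (1 / δ ^ 2) ^ 2)).and (eventually_ge_atTop (max m 2))).exists
    have hmn : m ≤ n := (le_max_left _ _).trans hn2
    set P := ∑ i ∈ Finset.Ico m n, p i with hP
    have hPs : ∑ i ∈ Finset.range m, p i + P = ∑ i ∈ Finset.range n, p i :=
      Finset.sum_range_add_sum_Ico _ hmn
    have hPδ : (1 / δ ^ 2) ^ 2 ≤ P := by linarith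
    have hP0 : 0 < P := lt_of_lt_of_le (by positivity) hPδ
    have hsq : 1 / δ ^ 2 ≤ √P := Real.le_sqrt_of_sq_le hPδ
    have hsP : 0 < √P := Real.sqrt_pos.2 hP0
    have hPP : √P * √P = P := Real.mul_self_sqrt hP0.le
    -- with this weight `a * P ≥ 1 / δ` is large while `a ^ 2 * P = δ ^ 2` is small
    set a := δ / √P with ha
    have hsumIte : ∀ c : ℝ, ∑ i ∈ Finset.range n, (if m ≤ i then c else 0) * p i = c * P := by
      intro c
      rw [hP, Finset.mul_sum, Finset.range_eq_Ico, ← Finset.sum_Ico_consecutive _ m.zero_le hmn,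
        Finset.sum_eq_zero (s := Finset.Ico 0 m), zero_add]
      · exact Finset.sum_congr rfl fun i hi => by rw [if_pos (Finset.mem_Ico.1 hi).1]
      · intro i hi
        rw [if_neg (not_le.2 (Finset.mem_Ico.1 hi).2), zero_mul]
    have key := le_V_exists_pos (n := n) hX hind hg hg0 hg1 (b := fun i => if m ≤ i then a else 0)
      (fun i => by split_ifs <;> positivity) ((le_max_right _ _).trans hn2)
    simp only [ite_pow, ne_eq, OfNat.ofNat_ne_zero, not_false_eq_true, zero_pow] at key
    rw [hsumIte, hsumIte] at key
    have haP : a * P = δ * √P := by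
      calc a * P = δ / √P * (√P * √P) := by rw [hPP]
        _ = δ * √P := by field_simp
    have ha2P : a ^ 2 * P = δ ^ 2 := by rw [ha, div_pow, Real.sq_sqrt hP0.le]; field_simp
    have hle : (1 + a * P)⁻¹ ≤ δ := by
      rw [haP]
      have h1 : δ⁻¹ ≤ δ * √P := by
        calc δ⁻¹ = δ * (1 / δ ^ 2) := by field_simp
          _ ≤ _ := by gcongr
      rw [inv_le_comm₀ (by positivity) hδ0]
      linarith
    rw [ha2P] at key
    refine (ENNReal.ofReal_le_ofReal ?_).trans (key.trans (V_mono ?_))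
    · linarith
    · rintro ω ⟨i, -, hi⟩
      by_cases hmi : m ≤ i
      · refine ⟨i, hmi, lt_of_le_of_ne (hg0 i _) fun h0 => ?_⟩
        simp [← h0] at hi
      · simp [hmi] at hi
  have hmU : ∀ m, MeasurableSet (U m) := by
    intro m
    have : U m = ⋃ i ≥ m, {ω | 0 < g i (X i ω)} := by ext ω; simp [hU]
    rw [this]
    exact .iUnion fun i => .iUnion fun _ => hmeas i
  have hlim := hV.2 U hmU fun m k hmk ω hω => by
    obtain ⟨i, hi, h⟩ := hω
    exact ⟨i, hmk.trans hi, h⟩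
  simp only [hU1] at hlim
  have heq : {ω | ∃ᶠ i in atTop, 0 < g i (X i ω)} = ⋂ m, U m := by
    ext ω; simp [hU, frequently_atTop]
  rw [heq]
  exact tendsto_nhds_unique hlim tendsto_const_nhds

/-! ### Necessity of the finite Choquet integral -/

theorem choquet_le_tsum (Y : Ω → ℝ) {s : ℝ} (hs : 0 < s) :
    choquet S.V Y ≤ ENNReal.ofReal s * (1 + ∑' i : ℕ, S.V {ω | s * (i + 1) ≤ Y ω}) := by
  calc choquet S.V Y
      ≤ ∫⁻ t in ⋃ i : ℕ, Set.Ioc (s * i) (s * (i + 1)), S.V {ω | t ≤ Y ω} := by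
        refine lintegral_mono_set fun t ht => ?_
        have ht' : 0 < t / s := div_pos ht hs
        obtain ⟨i, hi⟩ := Nat.exists_eq_succ_of_ne_zero (Nat.ceil_pos.2 ht').ne'
        refine Set.mem_iUnion.2 ⟨i, ?_, ?_⟩
        · have : i < ⌈t / s⌉₊ := by omega
          rw [Nat.lt_ceil, lt_div_iff₀' hs] at this
          exact this
        · have := Nat.le_ceil (t / s)
          rw [hi, div_le_iff₀' hs] at this
          exact_mod_cast this
    _ ≤ ∑' i : ℕ, ∫⁻ t in Set.Ioc (s * i) (s * (i + 1)), S.V {ω | t ≤ Y ω} :=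
        lintegral_iUnion_le _ _
    _ ≤ ∑' i : ℕ, ENNReal.ofReal s * S.V {ω | s * i ≤ Y ω} := by
        refine ENNReal.tsum_le_tsum fun i => ?_
        calc _ ≤ ∫⁻ _ in Set.Ioc (s * i) (s * (i + 1)), S.V {ω | s * i ≤ Y ω} := by
              refine setLIntegral_mono' measurableSet_Ioc fun t ht => V_mono fun ω hω => ?_
              exact ht.1.le.trans hω
          _ = _ := by
              rw [setLIntegral_const, Real.volume_Ioc, mul_comm]
              congr 2; ring
    _ = ENNReal.ofReal s * ∑' i : ℕ, S.V {ω | s * i ≤ Y ω} := ENNReal.tsum_mul_left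
    _ ≤ _ := by
        gcongr
        rw [tsum_eq_zero_add' ENNReal.summable]
        gcongr
        · exact V_le_one _
        · push_cast; rfl

theorem choquet_lt_top_of_extIndep (hX : ∀ n, X n ∈ S.H) (hid : ∀ n, S.SameDistrib (X n) (X 0))
    (hV : IsContinuousCapacity S.V) (hind : S.ExtIndep X)
    (hlt : S.V {ω | limsup (fun n : ℕ => ((|partialSum X n ω| / n : ℝ) : EReal)) atTop = ⊤} < 1) :
    choquet S.V (fun ω => |X 0 ω|) < ⊤ := by
  by_contra hch
  -- smoothed indicators of the events `|X i| > (M + 1) * (i + 1)`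
  set g : ℕ → ℕ → ℝ → ℝ := fun M i x =>
    max 0 (min (|x| / (((M : ℝ) + 1) * (i + 1)) - 1) 1) with hg
  have hpos : ∀ M i : ℕ, (0 : ℝ) < ((M : ℝ) + 1) * (i + 1) := fun M i => by positivity
  have hgL : ∀ M i, IsBddLip (g M i) := by
    intro M i
    refine .clamp (((M : ℝ) + 1) * (i + 1))⁻¹ (fun x y => ?_) 0 1 zero_le_one
    rw [sub_sub_sub_cancel_right, ← sub_div, abs_div, abs_of_pos (hpos M i), div_eq_inv_mul]
    exact mul_le_mul_of_nonneg_left (abs_abs_sub_abs_le x y) (inv_nonneg.2 (hpos M i).le)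
  have hgpos : ∀ M i x, 0 < g M i x ↔ ((M : ℝ) + 1) * (i + 1) < |x| := by
    intro M i x
    simp only [hg, lt_max_iff, lt_self_iff_false, false_or, lt_min_iff, zero_lt_one, and_true,
      sub_pos, one_lt_div (hpos M i)]
  have hmX : ∀ i, Measurable (X i) := fun i => S.measurable_of_mem _ (hX i)
  have hnot : ∀ M, ¬ Summable fun i => S.Er (fun ω => g M i (X i ω)) := by
    intro M hs
    refine hch (lt_of_le_of_lt (choquet_le_tsum (S := S) (fun ω => |X 0 ω|)
      (s := 2 * ((M : ℝ) + 1)) (by positivity)) ?_)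
    refine ENNReal.mul_lt_top ENNReal.ofReal_lt_top (ENNReal.add_lt_top.2 ⟨ENNReal.one_lt_top, ?_⟩)
    refine lt_of_le_of_lt (ENNReal.tsum_le_tsum fun i => ?_) (lt_top_iff_ne_top.2
      hs.tsum_ofReal_ne_top)
    rw [(hid i).Er_eq (hX i) (hX 0) (hgL M i)]
    refine V_le_of_indicator_le ((hgL M i).isBddRV (hX 0)) (fun ω => le_max_left _ _) fun ω hω => ?_
    have hω' : 2 * ((M : ℝ) + 1) * (i + 1) ≤ |X 0 ω| := hω
    refine le_max_of_le_right (le_min ?_ le_rfl)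
    have : 2 ≤ |X 0 ω| / (((M : ℝ) + 1) * (i + 1)) := by
      rw [le_div_iff₀ (hpos M i)]; linarith
    linarith
  set A : ℕ → Set Ω := fun M => {ω | ∃ᶠ i : ℕ in atTop, ((M : ℝ) + 1) * (i + 1) < |X i ω|} with hA
  have hmeas : ∀ M i : ℕ, MeasurableSet {ω | ((M : ℝ) + 1) * (i + 1) < |X i ω|} := fun M i =>
    measurableSet_lt measurable_const (hmX i).abs
  have hA1 : ∀ M, S.V (A M) = 1 := by
    intro M
    have := V_frequently_pos_eq_one hX hind hV (hgL M) (fun i x => le_max_left _ _)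
      (fun i x => max_le zero_le_one (min_le_right _ _))
      (fun i => by simpa only [hgpos] using hmeas M i) (hnot M)
    simpa only [hgpos] using this
  have hAm : ∀ M, MeasurableSet (A M) := fun M => by
    have : A M = limsup (fun i : ℕ => {ω | ((M : ℝ) + 1) * (i + 1) < |X i ω|}) atTop := by
      ext ω; simp [hA, mem_limsup_iff_frequently_mem]
    exact this ▸ MeasurableSet.measurableSet_limsup (hmeas M)
  have hlim := hV.2 A hAm fun M N hMN ω hω => hω.mono fun i hi => lt_of_le_of_lt (by gcongr) hi
  simp only [hA1] at hlim
  have h1 : S.V (⋂ M, A M) = 1 := tendsto_nhds_unique hlim tendsto_const_nhds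
  refine absurd hlt (not_lt.2 (h1.ge.trans (V_mono fun ω hω => ?_)))
  exact limsup_abs_partialSum_div_eq_top fun M => Set.mem_iInter.1 hω M

end SublinearSpace

theorem mainTheorem1 {Ω : Type*} [MeasurableSpace Ω] (S : SublinearSpace Ω)
    (X : ℕ → Ω → ℝ) (hX : ∀ n, X n ∈ S.H) (hid : ∀ n, S.SameDistrib (X n) (X 0)) :
    -- part (a)
    (Tendsto (fun c : ℝ => S.E (fun ω => max (|X 0 ω| - c) 0)) atTop (𝓝 0) →
      choquet S.V (fun ω => |X 0 ω|) < ⊤ →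
      (S.UpperEND X → S.outerV (S.upperEvent X) = 0) ∧
      (S.END X → S.outerV (S.lowerEvent X ∪ S.upperEvent X) = 0)) ∧
    -- part (b)
    (IsCountablySubadditive S.V →
      (∀ A : Set Ω, MeasurableSet A → S.outerV A = S.V A) ∧
      (Tendsto (fun c : ℝ => S.E (fun ω => max (|X 0 ω| - c) 0)) atTop (𝓝 0) →
        choquet S.V (fun ω => |X 0 ω|) < ⊤ →
        (S.UpperEND X → S.V (S.upperEvent X) = 0) ∧
        (S.END X → S.V (S.lowerEvent X ∪ S.upperEvent X) = 0))) ∧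
    -- part (c)
    (IsContinuousCapacity S.V → S.ExtIndep X →
      S.V {ω | limsup (fun n : ℕ => ((|partialSum X n ω| / n : ℝ) : EReal)) atTop = ⊤} < 1 →
      choquet S.V (fun ω => |X 0 ω|) < ⊤) := by
  refine ⟨fun hui hch => ⟨SublinearSpace.outerV_upperEvent hX hid hui hch,
      SublinearSpace.outerV_lowerEvent_union_upperEvent hX hid hui hch⟩,
    fun hV => ⟨fun A hA => SublinearSpace.V_eq_outerV hV hA, fun hui hch => ⟨fun h => ?_,
      fun h => ?_⟩⟩,
    SublinearSpace.choquet_lt_top_of_extIndep hX hid⟩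
  · rw [← SublinearSpace.V_eq_outerV hV (SublinearSpace.measurableSet_upperEvent hX)]
    exact SublinearSpace.outerV_upperEvent hX hid hui hch h
  · rw [← SublinearSpace.V_eq_outerV hV ((SublinearSpace.measurableSet_lowerEvent hX).union
      (SublinearSpace.measurableSet_upperEvent hX))]
    exact SublinearSpace.outerV_lowerEvent_union_upperEvent hX hid hui hch h
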